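/- **Inputs.** Fix $c\in\mathbb N$. Let $l\ge 1$, let $M$ be a multiple of $2l$, and let $N\le M$. The distribution $P_{M,l}$ on $N$-vertex graphs is generated as follows. Take disjoint sets $V_1,\dots,V_l$ of $M/l$ vertices each; on each $V_i$ choose $c$ perfect matchings, uniformly and independently. Then pick vertices $v_1,\dots,v_N$ one after the other: each time choose one of the sets $V_j$ uniformly at random, and then a uniformly random vertex of $V_j$ among those not chosen before (the process *fails* if there is none). The graph $G$ is the induced subgraph on $v_1,\dots,v_N$, with $v_u$ renamed $u$. It is accessed through the black box $f_G(u,j)$ ($1\le u\le N$, $1\le j\le c$), which is the neighbour of $u$ in the $j$-th matching if that neighbour is one of the chosen vertices, and $\bot$ otherwise. **Algorithms.** A $T$-query quantum algorithm has a finite-dimensional state space with basis $|u,j,z,w\rangle$, where $z$ is a bit string and $w$ a workspace label. It starts in a fixed basis state and applies input-independent unitaries $U_0,\dots,U_T$ with one query $|u,j,z,w\rangle\mapsto|u,j,z\oplus f_G(u,j),w\rangle$ between consecutive ones (values in $\{1,\dots,N,\bot\}$ are encoded injectively as bit strings). It accepts if a final measurement in the basis gives a label in a fixed set. For $\rho\in[0,1]$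 let $p_A^{\rho}(M,l)$ be the probability that $A$ accepts an input drawn from $P_{M,l}$, where $A$ is taken to accept with probability $\rho$ if the process fails. (Taking for $\rho$ the acceptance probability conditioned on success gives that conditional probability.) **Statement.** There is an absolute constant $K>0$ such that for all $c\in\mathbb N$ and $a>0$ there are $\kappa>0$ and $N_0$ such that for all $N\ge N_0$, all $T\le N^{1/2}$ and every $T$-query quantum algorithm $A$ for such inputs, there are real bivariate polynomials $f$ and $g$ and exponents $e_k\in\mathbb N$ with $$\deg f,\ \deg g\ \le\ K\,T\log(T+1),\qquad g(M,l)=\prod_{k=1}^{2T}\bigl(M-(2k-1)l\bigr)^{e_k},\qquad e_k\le \frac{2T}{k},$$ such that for all positive integers $M,l$ with $2l\mid M$, $l\le N^{1/4}$ and $M\ge(1+aN^{-0.1})N$ we have $g(M,l)\ne0$ and, for every $\rho\in[0,1]$, $$\left|\,p_A^{\rho}(M,l)-\frac{f(M,l)}{g(M,l)}\right|\ \le\ e^{-\kappa N^{0.55}} .$$ -/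

import Mathlib

namespace GraphQuery

/-! ### Inputs and quantum query algorithms -/

/-- The black box of a graph on the vertices `Fin N` that is a union of `c` labelled (partial)
matchings: `x v j` is the neighbour of `v` in the `j`-th matching, and `none` if `v` has no
neighbour in it. -/
abbrev Input (N c : ℕ) : Type := Fin N → Fin c → Option (Fin N)

/-- Labels of the computational basis states `|v, j, z, w⟩`: a vertex, an index into its adjacency
list, an answer register of `b` bits, and a workspace of dimension `s`. -/
abbrev Basis (N c b s : ℕ) : Type := Fin N × Fin c × (Fin b → Bool) × Fin s

/-- A quantum algorithm making `T` queries: an arbitrary finite workspace, an arbitrary binary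
encoding of the answers, an initial basis state, unitaries `U 0, …, U T` (the later ones are never
applied) that do not depend on the input, and a final measurement in the computational basis, whose
accepting outcomes are `accept`. -/
structure QueryAlgorithm (N c T : ℕ) where
  /-- number of bits of the answer register -/
  b : ℕ
  /-- dimension of the workspace -/
  s : ℕ
  /-- binary encoding of the answers -/
  enc : Option (Fin N) ↪ (Fin b → Bool)
  /-- initial basis state -/
  init : Basis N c b s
  /-- `U 0` is applied before the first query, `U t` after the `t`-th query -/
  U : ℕ → Matrix.unitaryGroup (Basis N c b s) ℂ
  /-- accepting outcomes -/
  accept : Finset (Basis N c b s)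

namespace QueryAlgorithm

variable {N c T : ℕ} (A : QueryAlgorithm N c T) (x : Input N c)

/-- The action `|v, j, z, w⟩ ↦ |v, j, z ⊕ x(v, j), w⟩` of a query on basis states. -/
def queryMap : Basis N c A.b A.s → Basis N c A.b A.s :=
  fun p => (p.1, p.2.1, fun i => xor (p.2.2.1 i) (A.enc (x p.1 p.2.1) i), p.2.2.2)

/-- The matrix of a query. -/
def oracle : Matrix (Basis N c A.b A.s) (Basis N c A.b A.s) ℂ :=
  Matrix.of fun p q => if p = A.queryMap x q then 1 else 0

/-- The state after `t` queries (and after `U t`). -/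
def state : ℕ → Basis N c A.b A.s → ℂ
  | 0 => (A.U 0 : Matrix _ _ ℂ).mulVec (Pi.single A.init 1)
  | t + 1 => (A.U (t + 1) : Matrix _ _ ℂ).mulVec ((A.oracle x).mulVec (state t))

/-- The probability that the algorithm accepts the input `x`. -/
noncomputable def acceptProbOn : ℝ := ∑ p ∈ A.accept, ‖A.state x T p‖ ^ 2

end QueryAlgorithm

/-! ### The distribution `P_{M,l}` -/

/-- Perfect matchings of `Fin m`, given by the map that sends every vertex to its partner: the
involutions without fixed points. -/
abbrev PerfectMatching (m : ℕ) : Type :=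
  {f : Fin m → Fin m // ∀ a, f (f a) = a ∧ f a ≠ a}

open Classical in
/-- A uniformly random element of `s`; drawing from the empty set fails (`none`). -/
noncomputable def draw {α : Type} (s : Finset α) : PMF (Option α) :=
  if h : s.Nonempty then (PMF.uniformOfFinset s h).map some else PMF.pure none

/-- Sequential composition of two random steps that may fail. -/
noncomputable def andThen {α β : Type} (p : PMF (Option α)) (q : α → PMF (Option β)) :
    PMF (Option β) :=
  p.bind fun o => o.elim (PMF.pure none) q

/-- The random choice of `v_1, …, v_n` among the vertices `Fin l × Fin m`, where the `j`-th set
`V_j` is `{j} × Fin m`: each time one of the `l` sets is chosen uniformly at random, and then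
a vertex of this set, uniformly at random among those not chosen before. The process fails if there
is none. -/
noncomputable def pickVertices (l m : ℕ) : (n : ℕ) → PMF (Option (Fin n → Fin l × Fin m))
  | 0 => PMF.pure (some Fin.elim0)
  | n + 1 =>
    andThen (pickVertices l m n) fun v =>
      andThen (draw (Finset.univ : Finset (Fin l))) fun j =>
        andThen (draw (Finset.univ.filter fun a : Fin m => ∀ i, v i ≠ (j, a))) fun a =>
          PMF.pure (some (Fin.snoc (α := fun _ => Fin l × Fin m) v (j, a)))

open Classical in
/-- The black box of the subgraph induced on the chosen vertices `v 0, …, v (N - 1)`, the vertex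
`v u` being renamed `u`, where `σ i j` is the `j`-th matching on `V_i`. -/
noncomputable def inducedInput {N c l m : ℕ} (σ : Fin l → Fin c → PerfectMatching m)
    (v : Fin N → Fin l × Fin m) : Input N c := fun u j =>
  if h : ∃ w, v w = ((v u).1, (σ (v u).1 j).1 (v u).2) then some h.choose else none

/-- The distribution `P_{M,l}` of graphs on `N` vertices (`none` stands for failure of the
process): in each of the `l` sets of `M / l` vertices, `c` perfect matchings are chosen uniformly
and independently; then `N` vertices are picked, and the induced subgraph is returned. It is meant
for positive `l` and even integers `M / l`. -/
noncomputable def graphDist (N c M l : ℕ) : PMF (Option (Input N c)) :=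
  andThen (draw (Finset.univ : Finset (Fin l → Fin c → PerfectMatching (M / l)))) fun σ =>
    andThen (pickVertices l (M / l) N) fun v => PMF.pure (some (inducedInput σ v))

/-- The acceptance probability of `A` on an input drawn from `P_{M,l}`, if the algorithm is taken to
accept with probability `ρ` when the process that generates the input fails. -/
noncomputable def acceptProb {N c T : ℕ} (A : QueryAlgorithm N c T) (M l : ℕ) (ρ : ℝ) : ℝ :=
  ∑ o : Option (Input N c), (graphDist N c M l o).toReal * o.elim ρ A.acceptProbOn

/-- The linear polynomial `M - (2k - 1) l` in the variables `M = X 0` and `l = X 1`. -/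
noncomputable def linFactor (k : ℕ) : MvPolynomial (Fin 2) ℝ :=
  MvPolynomial.X 0 - MvPolynomial.C (2 * (k : ℝ) - 1) * MvPolynomial.X 1

end GraphQuery

namespace GraphQuery

/-! By the polynomial method, the acceptance probability on a fixed input is a combination of
indicators "all edges of the list `L` are present" with `L.length ≤ 2T`. There are `exp (O(√N log
N))` terms, with coefficients in `[-1, 1]` (`exists_acceptProbOn_expansion`).

Let `φ` assign classes to the vertices. The edges of a list are then all present with a probability
depending only on `φ` and on the class size `μ = M / l`: it is `0` unless every edge stays inside a
class, and otherwise each matching with `k` prescribed edges contributes `1 / ((μ - 1)(μ - 3)⋯(μ -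
2k + 1))` (`card_contains`). The classes are uniform and independent until some class overflows,
which is failure (`expect_pickVertices`). So, up to the number of terms times the overflow
probability, the acceptance probability is the average of these weights over all `φ`, overflowing
ones included.

This average is rational with a common denominator. At most `2T / k` matchings have `k` or more
prescribed edges, so with `ε = l / M` the product of the `(1 - (2k - 1)ε) ^ (2T / k)` clears every
weight. In what remains, the coefficient of `ε ^ n` is a combination of products of at most `n`
coincidences `φ u = φ v` (`coeff_leftover_mem_pairSpan`). Averaging a product of `h` coincidences
gives `l ^ (-j)` with `j ≤ h`, so the powers of `l` in `ε` cancel all negative powers of `l`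
(`exists_average_eq_polynomial`). The degree is at most `∑ 2T / k = O(T log T)`.

A Chernoff bound makes overflow `exp (-Ω(N ^ 0.55))` likely, which beats the number of terms. -/

/-! ### Acceptance probabilities as polynomials of degree `2 T` -/

/-- The edge from `e.1` to `e.2.2` in the matching with label `e.2.1`. -/
abbrev Edge (N c : ℕ) : Type := Fin N × Fin c × Fin N

/-- The input contains all edges of a list. -/
def Sat {N c : ℕ} (x : Input N c) (L : List (Edge N c)) : Prop :=
  ∀ e ∈ L, x e.1 e.2.1 = some e.2.2

theorem sat_append {N c : ℕ} (x : Input N c) (L L' : List (Edge N c)) :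
    Sat x (L ++ L') ↔ Sat x L ∧ Sat x L' := by
  simp only [Sat, List.mem_append, or_imp, forall_and]

theorem sum_norm_sq_unitary {B : Type} [Fintype B] [DecidableEq B]
    (U : Matrix.unitaryGroup B ℂ) (ψ : B → ℂ) :
    ∑ p, ‖(U : Matrix B B ℂ).mulVec ψ p‖ ^ 2 = ∑ p, ‖ψ p‖ ^ 2 := by
  have key : ∀ φ : B → ℂ, ((∑ p, ‖φ p‖ ^ 2 : ℝ) : ℂ) = star φ ⬝ᵥ φ := by
    intro φ
    simp only [dotProduct, Pi.star_apply, Complex.ofReal_sum, Complex.ofReal_pow]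
    refine Finset.sum_congr rfl fun p _ => ?_
    rw [← Complex.conj_mul']
    rfl
  have h : star ((U : Matrix B B ℂ).mulVec ψ) ⬝ᵥ (U : Matrix B B ℂ).mulVec ψ = star ψ ⬝ᵥ ψ := by
    rw [Matrix.star_mulVec, Matrix.dotProduct_mulVec, Matrix.vecMul_vecMul]
    have : (U : Matrix B B ℂ).conjTranspose * (U : Matrix B B ℂ) = 1 :=
      Matrix.UnitaryGroup.star_mul_self U
    rw [this, Matrix.vecMul_one]
  exact_mod_cast (key _).trans (h.trans (key _).symm)

namespace QueryAlgorithm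

variable {N c T : ℕ} (A : QueryAlgorithm N c T)

/-- The action of a query that is answered by `o`. -/
def answerMap (o : Option (Fin N)) (p : Basis N c A.b A.s) : Basis N c A.b A.s :=
  (p.1, p.2.1, fun i => xor (p.2.2.1 i) (A.enc o i), p.2.2.2)

theorem answerMap_involutive (o : Option (Fin N)) : Function.Involutive (A.answerMap o) := by
  rintro ⟨u, j, z, w⟩
  simp [answerMap]

theorem oracle_mulVec (x : Input N c) (ψ : Basis N c A.b A.s → ℂ) (p : Basis N c A.b A.s) :
    (A.oracle x).mulVec ψ p = ψ (A.answerMap (x p.1 p.2.1) p) := by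
  have h : ∀ q, (p = A.queryMap x q) ↔ A.answerMap (x p.1 p.2.1) p = q := by
    intro q
    constructor
    · rintro rfl
      exact A.answerMap_involutive (x q.1 q.2.1) q
    · rintro rfl
      exact (A.answerMap_involutive (x p.1 p.2.1) p).symm
  simp only [Matrix.mulVec, dotProduct, oracle, Matrix.of_apply, h, ite_mul, one_mul, zero_mul,
    Finset.sum_ite_eq, Finset.mem_univ, if_true]

/-- The terms in the expansion of a query as a polynomial in the indicators of edges. -/
def term (ψ : Basis N c A.b A.s → ℂ) : Option (Bool × Edge N c) → Basis N c A.b A.s → ℂ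
  | none => fun p => ψ (A.answerMap none p)
  | some (true, e) => fun p =>
      if p.1 = e.1 ∧ p.2.1 = e.2.1 then ψ (A.answerMap (some e.2.2) p) else 0
  | some (false, e) => fun p =>
      if p.1 = e.1 ∧ p.2.1 = e.2.1 then -ψ (A.answerMap none p) else 0

/-- The edges on which a term in the expansion of a query depends. -/
def termEdges : Option (Bool × Edge N c) → List (Edge N c)
  | none => []
  | some (_, e) => [e]

theorem sum_norm_sq_term_le (ψ : Basis N c A.b A.s → ℂ) (r : Option (Bool × Edge N c)) :
    ∑ p, ‖A.term ψ r p‖ ^ 2 ≤ ∑ p, ‖ψ p‖ ^ 2 := by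
  have h : ∀ o, ∑ p, ‖ψ (A.answerMap o p)‖ ^ 2 = ∑ p, ‖ψ p‖ ^ 2 := fun o =>
    Equiv.sum_comp (A.answerMap_involutive o).toPerm (fun p => ‖ψ p‖ ^ 2)
  rcases r with _ | ⟨_ | _, e⟩
  · exact (h none).le
  · rw [← h none]
    refine Finset.sum_le_sum fun p _ => ?_
    simp only [term]
    split_ifs <;> simp
  · rw [← h (some e.2.2)]
    refine Finset.sum_le_sum fun p _ => ?_
    simp only [term]
    split_ifs <;> simp

-- The value at a basis state is the one for the answer `none`, corrected by a difference of two
-- terms for each possible neighbour. Thus `none` itself needs no indicator.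
open Classical in
theorem oracle_mulVec_eq_sum (x : Input N c) (ψ : Basis N c A.b A.s → ℂ) :
    (A.oracle x).mulVec ψ
      = ∑ r, (if Sat x (termEdges r) then (1 : ℂ) else 0) • A.term ψ r := by
  funext p
  rw [oracle_mulVec, Fintype.sum_option, Fintype.sum_prod_type, Fintype.sum_bool]
  simp only [Pi.add_apply, Finset.sum_apply, Pi.smul_apply, smul_eq_mul, term, termEdges, Sat,
    List.not_mem_nil, List.mem_singleton, forall_eq, false_imp_iff, imp_true_iff, if_true, one_mul,
    ← Finset.sum_add_distrib]
  rw [Fintype.sum_prod_type, Finset.sum_eq_single p.1, Fintype.sum_prod_type,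
    Finset.sum_eq_single p.2.1]
  · rcases hx : x p.1 p.2.1 with _ | w
    · simp [hx]
    · simp [hx, Finset.sum_add_distrib]
  · intro j _ hj
    simp [Ne.symm hj]
  · simp
  · intro u _ hu
    simp [Ne.symm hu]
  · simp

open Classical in
/-- The state after `t` queries is a polynomial of degree `t` in the indicators of edges. -/
theorem exists_state_expansion (t : ℕ) :
    ∃ (ι : Type) (_ : Fintype ι) (L : ι → List (Edge N c)) (ψ : ι → Basis N c A.b A.s → ℂ),
      Fintype.card ι ≤ (1 + 2 * (N * (c * N))) ^ t ∧ (∀ i, (L i).length ≤ t) ∧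
      (∀ i, ∑ p, ‖ψ i p‖ ^ 2 ≤ 1) ∧
      ∀ x, A.state x t = ∑ i, (if Sat x (L i) then (1 : ℂ) else 0) • ψ i := by
  induction t with
  | zero =>
    refine ⟨Unit, inferInstance, fun _ => [],
      fun _ => (A.U 0 : Matrix _ _ ℂ).mulVec (Pi.single A.init 1), by simp, by simp, fun _ => ?_,
      fun x => by simp [state, Sat]⟩
    rw [sum_norm_sq_unitary]
    refine le_of_eq ?_
    rw [Finset.sum_eq_single A.init] <;> simp +contextual
  | succ t ih =>
    obtain ⟨ι, _, L, ψ, hc, hL, hψ, hs⟩ := ih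
    refine ⟨ι × Option (Bool × Edge N c), inferInstance, fun q => termEdges q.2 ++ L q.1,
      fun q => (A.U (t + 1) : Matrix _ _ ℂ).mulVec (A.term (ψ q.1) q.2), ?_, ?_, ?_, ?_⟩
    · rw [Fintype.card_prod, pow_succ]
      refine Nat.mul_le_mul hc (le_of_eq ?_)
      simp [add_comm]
    · rintro ⟨i, _ | ⟨b, e⟩⟩ <;> have := hL i <;> simp [termEdges] <;> omega
    · rintro ⟨i, r⟩
      rw [sum_norm_sq_unitary]
      exact (A.sum_norm_sq_term_le _ _).trans (hψ i)
    · intro x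
      simp only [state, hs x]
      rw [Fintype.sum_prod_type, Matrix.mulVec_sum, Matrix.mulVec_sum]
      refine Finset.sum_congr rfl fun i _ => ?_
      rw [Matrix.mulVec_smul, oracle_mulVec_eq_sum, Matrix.mulVec_smul, Matrix.mulVec_sum,
        Finset.smul_sum]
      refine Finset.sum_congr rfl fun r _ => ?_
      rw [Matrix.mulVec_smul, smul_smul]
      congr 1
      simp only [sat_append]
      by_cases h1 : Sat x (L i) <;> by_cases h2 : Sat x (termEdges r) <;> simp [h1, h2]

open Classical in
/-- The acceptance probability is a polynomial of degree `2 T` in the indicators of edges. -/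
theorem exists_acceptProbOn_expansion :
    ∃ (ι : Type) (_ : Fintype ι) (L : ι → List (Edge N c)) (w : ι → ℝ),
      Fintype.card ι ≤ (1 + 2 * (N * (c * N))) ^ (2 * T) ∧ (∀ i, (L i).length ≤ 2 * T) ∧
      (∀ i, |w i| ≤ 1) ∧
      ∀ x, A.acceptProbOn x = ∑ i, w i * (if Sat x (L i) then (1 : ℝ) else 0) := by
  obtain ⟨ι, _, L, ψ, hc, hL, hψ, hs⟩ := A.exists_state_expansion T
  -- Squaring the state pairs its terms; the weight of a pair is an inner product on the accepting
  -- subspace, bounded by AM-GM.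
  refine ⟨ι × ι, inferInstance, fun q => L q.1 ++ L q.2,
    fun q => ∑ p ∈ A.accept, (ψ q.1 p * star (ψ q.2 p)).re, ?_, ?_, ?_, ?_⟩
  · rw [Fintype.card_prod, two_mul T, pow_add]
    exact Nat.mul_le_mul hc hc
  · intro q
    have h1 := hL q.1
    have h2 := hL q.2
    simp only [List.length_append]
    omega
  · intro q
    calc |∑ p ∈ A.accept, (ψ q.1 p * star (ψ q.2 p)).re|
        ≤ ∑ p ∈ A.accept, |(ψ q.1 p * star (ψ q.2 p)).re| := Finset.abs_sum_le_sum_abs _ _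
      _ ≤ ∑ p ∈ A.accept, (‖ψ q.1 p‖ ^ 2 + ‖ψ q.2 p‖ ^ 2) / 2 := by
          refine Finset.sum_le_sum fun p _ => (Complex.abs_re_le_norm _).trans ?_
          rw [norm_mul, norm_star]
          nlinarith [sq_nonneg (‖ψ q.1 p‖ - ‖ψ q.2 p‖)]
      _ ≤ ∑ p, (‖ψ q.1 p‖ ^ 2 + ‖ψ q.2 p‖ ^ 2) / 2 :=
          Finset.sum_le_sum_of_subset_of_nonneg (Finset.subset_univ _) fun p _ _ => by positivity
      _ ≤ 1 := by
          rw [← Finset.sum_div, Finset.sum_add_distrib]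
          linarith [hψ q.1, hψ q.2]
  · intro x
    have h : ∀ p, ‖A.state x T p‖ ^ 2 = ∑ q : ι × ι, (ψ q.1 p * star (ψ q.2 p)).re
        * (if Sat x (L q.1 ++ L q.2) then (1 : ℝ) else 0) := by
      intro p
      have h1 : ‖A.state x T p‖ ^ 2 = (A.state x T p * star (A.state x T p)).re := by
        have := Complex.mul_conj' (A.state x T p)
        rw [show star (A.state x T p) = (starRingEnd ℂ) (A.state x T p) from rfl, this]
        norm_cast
      rw [h1, hs x]
      simp only [Finset.sum_apply, Pi.smul_apply, star_sum, Finset.sum_mul_sum, smul_eq_mul]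
      rw [Complex.re_sum, Fintype.sum_prod_type]
      refine Finset.sum_congr rfl fun i _ => ?_
      rw [Complex.re_sum]
      refine Finset.sum_congr rfl fun j _ => ?_
      simp only [sat_append]
      by_cases h1 : Sat x (L i) <;> by_cases h2 : Sat x (L j) <;> simp [h1, h2]
    simp only [acceptProbOn, h]
    rw [Finset.sum_comm]
    exact Finset.sum_congr rfl fun q _ => (Finset.sum_mul _ _ _).symm

end QueryAlgorithm

/-! ### Expectations -/

/-- The expectation of a function on a finite type. -/
noncomputable def expect {α : Type} [Fintype α] (p : PMF α) (F : α → ℝ) : ℝ :=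
  ∑ a, (p a).toReal * F a

theorem expect_bind {α β : Type} [Fintype α] [Fintype β] (p : PMF α) (q : α → PMF β) (F : β → ℝ) :
    expect (p.bind q) F = expect p fun a => expect (q a) F := by
  have h : ∀ b, ((p.bind q) b).toReal = ∑ a, (p a).toReal * (q a b).toReal := by
    intro b
    rw [PMF.bind_apply, tsum_fintype, ENNReal.toReal_sum]
    · simp
    · exact fun a _ => ENNReal.mul_ne_top (p.apply_ne_top a) ((q a).apply_ne_top b)
  simp only [expect, h, Finset.sum_mul, Finset.mul_sum, mul_assoc]
  exact Finset.sum_comm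

theorem expect_pure {α : Type} [Fintype α] (a : α) (F : α → ℝ) :
    expect (PMF.pure a) F = F a := by
  classical
  rw [expect, Finset.sum_eq_single a] <;> simp +contextual

theorem expect_map {α β : Type} [Fintype α] [Fintype β] (p : PMF α) (f : α → β) (F : β → ℝ) :
    expect (p.map f) F = expect p fun a => F (f a) := by
  rw [← PMF.bind_pure_comp, expect_bind]
  simp [expect_pure]

theorem expect_congr {α : Type} [Fintype α] (p : PMF α) {F G : α → ℝ} (h : ∀ a, F a = G a) :
    expect p F = expect p G := by
  rw [funext h]

theorem expect_sum {α κ : Type} [Fintype α] (p : PMF α) (s : Finset κ) (F : κ → α → ℝ) :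
    ∑ k ∈ s, expect p (F k) = expect p fun a => ∑ k ∈ s, F k a := by
  simp only [expect, Finset.mul_sum]
  exact Finset.sum_comm

theorem expect_div {α : Type} [Fintype α] (p : PMF α) (F : α → ℝ) (r : ℝ) :
    expect p F / r = expect p fun a => F a / r := by
  simp only [expect, Finset.sum_div, mul_div_assoc]

theorem expect_andThen {α β : Type} [Fintype α] [Fintype β] (p : PMF (Option α))
    (q : α → PMF (Option β)) (ρ : ℝ) (F : β → ℝ) :
    expect (andThen p q) (fun o => o.elim ρ F)
      = expect p fun o => o.elim ρ fun a => expect (q a) fun o' => o'.elim ρ F := by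
  rw [andThen, expect_bind]
  refine expect_congr _ fun o => ?_
  cases o <;> simp [expect_pure]

theorem expect_draw {α : Type} [Fintype α] (s : Finset α) (ρ : ℝ) (F : α → ℝ) :
    expect (draw s) (fun o => o.elim ρ F)
      = if s.Nonempty then (∑ a ∈ s, F a) / s.card else ρ := by
  classical
  rw [draw]
  split_ifs with h
  · rw [expect_map, expect, Finset.sum_div]
    simp only [PMF.uniformOfFinset_apply, Option.elim]
    rw [← Finset.sum_subset (Finset.subset_univ s)]
    · refine Finset.sum_congr rfl fun a ha => ?_
      simp [ha, div_eq_inv_mul]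
    · intro a _ ha
      simp [ha]
  · rw [expect_pure]
    rfl

theorem expect_draw_univ {α : Type} [Fintype α] [Nonempty α] (ρ : ℝ) (F : α → ℝ) :
    expect (draw (Finset.univ : Finset α)) (fun o => o.elim ρ F)
      = (∑ a, F a) / Fintype.card α := by
  rw [expect_draw, if_pos Finset.univ_nonempty, Finset.card_univ]

/-! ### The classes of the chosen vertices -/

/-- An assignment of classes to vertices that gives no class more than `m` of them. -/
def Fits {l n : ℕ} (m : ℕ) (φ : Fin n → Fin l) : Prop :=
  ∀ i, (Finset.univ.filter fun u => φ u = i).card ≤ m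

theorem card_fiber_snoc {l n : ℕ} (φ : Fin n → Fin l) (j i : Fin l) :
    (Finset.univ.filter fun u => Fin.snoc (α := fun _ => Fin l) φ j u = i).card
      = (Finset.univ.filter fun u => φ u = i).card + if j = i then 1 else 0 := by
  simp only [Finset.card_filter]
  rw [Fin.sum_univ_castSucc]
  simp

theorem fits_snoc {l n m : ℕ} (φ : Fin n → Fin l) (j : Fin l) :
    Fits m (Fin.snoc (α := fun _ => Fin l) φ j)
      ↔ Fits m φ ∧ (Finset.univ.filter fun u => φ u = j).card < m := by
  simp only [Fits, card_fiber_snoc]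
  constructor
  · intro h
    exact ⟨fun i => (Nat.le_add_right _ _).trans (h i), by simpa using h j⟩
  · rintro ⟨h, hj⟩ i
    split_ifs with hi
    · subst hi
      exact hj
    · exact h i

theorem card_free {l n m : ℕ} (v : Fin n → Fin l × Fin m) (hv : Function.Injective v) (j : Fin l) :
    (Finset.univ.filter fun a : Fin m => ∀ i, v i ≠ (j, a)).card
      + (Finset.univ.filter fun u => (v u).1 = j).card = m := by
  have h : (Finset.univ.filter fun a : Fin m => ¬ ∀ i, v i ≠ (j, a)).card
      = (Finset.univ.filter fun u => (v u).1 = j).card := by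
    symm
    refine Finset.card_bij (fun u _ => (v u).2) ?_ ?_ ?_
    · intro u hu
      simp only [Finset.mem_filter, Finset.mem_univ, true_and] at hu ⊢
      push Not
      exact ⟨u, by rw [← hu]⟩
    · intro u hu u' hu' h
      simp only [Finset.mem_filter, Finset.mem_univ, true_and] at hu hu'
      exact hv (Prod.ext (hu.trans hu'.symm) h)
    · intro a ha
      simp only [Finset.mem_filter, Finset.mem_univ, true_and] at ha
      push Not at ha
      obtain ⟨u, hu⟩ := ha
      exact ⟨u, by simp [hu], by simp [hu]⟩
  rw [← h, Finset.card_filter_add_card_filter_not]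
  simp

open Classical in
/-- The classes of the vertices are uniformly distributed, and the process fails if a class is
chosen too often. -/
theorem expect_pickVertices {l m : ℕ} (hl : 0 < l) (ρ : ℝ) (n : ℕ) :
    ∀ (F : (Fin n → Fin l × Fin m) → ℝ) (G : (Fin n → Fin l) → ℝ),
      (∀ v, Function.Injective v → F v = G fun u => (v u).1) →
      expect (pickVertices l m n) (fun o => o.elim ρ F)
        = (∑ φ, if Fits m φ then G φ else ρ) / (l : ℝ) ^ n := by
  have : Nonempty (Fin l) := ⟨⟨0, hl⟩⟩
  have hl' : (l : ℝ) ≠ 0 := by positivity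
  induction n with
  | zero =>
    intro F G h
    rw [pickVertices, expect_pure]
    simp only [Option.elim, pow_zero, div_one]
    rw [h _ (fun a => a.elim0), Fintype.sum_unique, if_pos]
    · congr 1
      funext u
      exact u.elim0
    · intro i
      simp
  | succ n ih =>
    intro F G h
    -- The last step sees the earlier vertices only through the class sizes, so the induction
    -- hypothesis applies to its average over `j`.
    rw [pickVertices, expect_andThen, ih _ fun φ => (∑ j, if (Finset.univ.filter fun u => φ u = j).card
      < m then G (Fin.snoc (α := fun _ => Fin l) φ j) else ρ) / l]
    · rw [← (Fin.snocEquiv fun _ => Fin l).sum_comp, Fintype.sum_prod_type_right, pow_succ', ← div_div,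
        Finset.sum_div _ _ (l : ℝ)]
      congr 1
      refine Finset.sum_congr rfl fun φ _ => ?_
      have hs : ∀ j, (Fin.snocEquiv fun _ => Fin l) (j, φ) = Fin.snoc (α := fun _ => Fin l) φ j :=
        fun _ => rfl
      simp only [hs, fits_snoc]
      -- If `φ` does not fit, neither does any extension, and the average over `j` of the constant
      -- `ρ` is `ρ`.
      split_ifs with hφ
      · simp [hφ]
      · simp [hφ, hl']
    · intro v hv
      rw [expect_andThen, expect_draw_univ, Fintype.card_fin]
      congr 1
      refine Finset.sum_congr rfl fun j _ => ?_
      rw [expect_andThen, expect_draw]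
      have hc := card_free v hv j
      have hpos : (Finset.univ.filter fun a : Fin m => ∀ i, v i ≠ (j, a)).Nonempty
          ↔ (Finset.univ.filter fun u => (v u).1 = j).card < m := by
        rw [← Finset.card_pos]
        omega
      simp only [hpos]
      split_ifs with hj
      · have hne : ((Finset.univ.filter fun a : Fin m => ∀ i, v i ≠ (j, a)).card : ℝ) ≠ 0 := by
          exact_mod_cast (Finset.card_pos.2 (hpos.2 hj)).ne'
        rw [div_eq_iff hne, Finset.sum_congr rfl, Finset.sum_const, nsmul_eq_mul, mul_comm]
        intro a ha
        simp only [Finset.mem_filter, Finset.mem_univ, true_and] at ha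
        rw [expect_pure, Option.elim, h _ (Fin.snoc_injective_iff.2 ⟨hv, ?_⟩)]
        · congr 1
          funext u
          refine Fin.lastCases ?_ (fun u => ?_) u <;> simp
        · rintro ⟨u, hu⟩
          exact ha u hu
      · rfl

/-! ### Random matchings containing prescribed edges -/

section Lists

variable {N c : ℕ}

/-- Two edges have different labels or no common vertex. -/
def EdgeDisjoint (e e' : Edge N c) : Prop :=
  e.2.1 = e'.2.1 → e.1 ≠ e'.1 ∧ e.1 ≠ e'.2.2 ∧ e.2.2 ≠ e'.1 ∧ e.2.2 ≠ e'.2.2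

/-- The list consists of distinct edges of labelled matchings, each listed in one direction only. -/
def IsMatchingList (R : List (Edge N c)) : Prop :=
  R.Pairwise EdgeDisjoint ∧ ∀ e ∈ R, e.1 ≠ e.2.2

theorem isMatchingList_cons {e : Edge N c} {R : List (Edge N c)} :
    IsMatchingList (e :: R)
      ↔ (∀ e' ∈ R, EdgeDisjoint e e') ∧ e.1 ≠ e.2.2 ∧ IsMatchingList R := by
  simp only [IsMatchingList, List.pairwise_cons, List.forall_mem_cons]
  tauto

/-- The black box of a union of labelled partial matchings. -/
def IsMatchingInput (x : Input N c) : Prop :=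
  ∀ u j w, x u j = some w → x w j = some u ∧ u ≠ w

/-- A vertex has at most one neighbour per label, so present edges with a common label and vertex
agree up to reversal. -/
theorem IsMatchingInput.edgeDisjoint {x : Input N c} (hx : IsMatchingInput x) {e e' : Edge N c}
    (he : x e.1 e.2.1 = some e.2.2) (he' : x e'.1 e'.2.1 = some e'.2.2) (h1 : e ≠ e')
    (h2 : (e.2.2, e.2.1, e.1) ≠ e') : EdgeDisjoint e e' := by
  obtain ⟨u, j, w⟩ := e
  obtain ⟨u', j', w'⟩ := e'
  rintro (rfl : j = j')
  simp only at he he'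
  have hr := (hx _ _ _ he).1
  have hr' := (hx _ _ _ he').1
  refine ⟨?_, ?_, ?_, ?_⟩ <;> rintro h <;> simp only at h <;> subst h <;> simp_all

/-- Loops and conflicting edges make the list unsatisfiable; repeated or reversed edges are
redundant and can be dropped. -/
theorem exists_isMatchingList (L : List (Edge N c)) :
    (∀ x : Input N c, IsMatchingInput x → ¬ Sat x L) ∨
      ∃ R : List (Edge N c), IsMatchingList R ∧ R.length ≤ L.length ∧
        ∀ x : Input N c, IsMatchingInput x → (Sat x L ↔ Sat x R) := by
  induction L with
  | nil => exact Or.inr ⟨[], ⟨List.Pairwise.nil, by simp⟩, le_rfl, fun _ _ => Iff.rfl⟩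
  | cons e L ih =>
    have hcons : ∀ x : Input N c, Sat x (e :: L) ↔ x e.1 e.2.1 = some e.2.2 ∧ Sat x L := fun x =>
      List.forall_mem_cons
    rcases ih with h | ⟨R, hR, hlen, hsat⟩
    · exact Or.inl fun x hx hs => h x hx ((hcons x).1 hs).2
    by_cases hloop : e.1 = e.2.2
    · exact Or.inl fun x hx hs => (hx _ _ _ ((hcons x).1 hs).1).2 hloop
    by_cases h1 : e ∈ R
    · refine Or.inr ⟨R, hR, hlen.trans (by simp), fun x hx => ?_⟩
      rw [hcons, hsat x hx]
      exact ⟨fun h => h.2, fun h => ⟨h e h1, h⟩⟩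
    by_cases h2 : (e.2.2, e.2.1, e.1) ∈ R
    · refine Or.inr ⟨R, hR, hlen.trans (by simp), fun x hx => ?_⟩
      rw [hcons, hsat x hx]
      exact ⟨fun h => h.2, fun h => ⟨(hx _ _ _ (h _ h2)).1, h⟩⟩
    by_cases h3 : ∀ e' ∈ R, EdgeDisjoint e e'
    · refine Or.inr ⟨e :: R, isMatchingList_cons.2 ⟨h3, hloop, hR⟩, by simpa using hlen,
        fun x hx => ?_⟩
      rw [hcons, hsat x hx]
      exact (List.forall_mem_cons (p := fun e : Edge N c => x e.1 e.2.1 = some e.2.2)).symm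
    · refine Or.inl fun x hx hs => h3 fun e' he' => ?_
      rw [hcons, hsat x hx] at hs
      exact hx.edgeDisjoint hs.1 (hs.2 e' he') (fun h => h1 (h ▸ he')) (fun h => h2 (h ▸ he'))

end Lists

/-! ### Counting the matchings that contain a list of edges. -/

section Counting

variable {N c l m : ℕ}

/-- The matching to which an edge belongs, if vertices are assigned to classes by `φ`. -/
def edgeClass (φ : Fin N → Fin l) (e : Edge N c) : Fin l × Fin c := (φ e.1, e.2.1)

/-- The probability that the edges of `R` are present if vertices are assigned to classes of size
`μ` by `φ`. -/
noncomputable def edgeWeight (μ : ℝ) (φ : Fin N → Fin l) : List (Edge N c) → ℝ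
  | [] => 1
  | e :: R => edgeWeight μ φ R * (if φ e.1 = φ e.2.2 then 1 else 0)
      * (μ - (2 * ((R.map (edgeClass φ)).count (edgeClass φ e) : ℝ) + 1))⁻¹

/-- The matchings contain the edges of a list. -/
def Contains (σ : Fin l → Fin c → PerfectMatching m) (v : Fin N → Fin l × Fin m)
    (R : List (Edge N c)) : Prop :=
  ∀ e ∈ R, v e.2.2 = ((v e.1).1, (σ (v e.1).1 e.2.1).1 (v e.1).2)

theorem contains_cons (σ : Fin l → Fin c → PerfectMatching m) (v : Fin N → Fin l × Fin m)
    (e : Edge N c) (R : List (Edge N c)) :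
    Contains σ v (e :: R)
      ↔ v e.2.2 = ((v e.1).1, (σ (v e.1).1 e.2.1).1 (v e.1).2) ∧ Contains σ v R :=
  List.forall_mem_cons

theorem inducedInput_eq_some {σ : Fin l → Fin c → PerfectMatching m} {v : Fin N → Fin l × Fin m}
    (hv : Function.Injective v) (u : Fin N) (j : Fin c) (w : Fin N) :
    inducedInput σ v u j = some w ↔ v w = ((v u).1, (σ (v u).1 j).1 (v u).2) := by
  rw [inducedInput]
  split_ifs with h
  · rw [Option.some_inj]
    constructor
    · rintro rfl
      exact h.choose_spec
    · intro hw
      exact hv (h.choose_spec.trans hw.symm)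
  · simp only [false_iff]
    exact fun hw => h ⟨w, hw⟩

theorem sat_inducedInput {σ : Fin l → Fin c → PerfectMatching m} {v : Fin N → Fin l × Fin m}
    (hv : Function.Injective v) (R : List (Edge N c)) :
    Sat (inducedInput σ v) R ↔ Contains σ v R := by
  simp only [Sat, Contains, inducedInput_eq_some hv]

theorem isMatchingInput_inducedInput {σ : Fin l → Fin c → PerfectMatching m}
    {v : Fin N → Fin l × Fin m} (hv : Function.Injective v) :
    IsMatchingInput (inducedInput σ v) := by
  intro u j w h
  rw [inducedInput_eq_some hv] at h ⊢
  have hσ := (σ (v u).1 j).2 (v u).2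
  constructor
  · rw [h]
    simp [hσ.1]
  · rintro rfl
    exact hσ.2 (congrArg Prod.snd h).symm

/-- Relabelling the vertices of a perfect matching. -/
def relabel (τ : Equiv.Perm (Fin m)) (f : PerfectMatching m) : PerfectMatching m :=
  ⟨fun a => τ (f.1 (τ.symm a)), fun a => ⟨by simp [(f.2 _).1], fun h => (f.2 (τ.symm a)).2 (by
    rw [← τ.symm_apply_eq.2 h.symm])⟩⟩

theorem relabel_injective (τ : Equiv.Perm (Fin m)) : Function.Injective (relabel τ) := by
  intro f g h
  refine Subtype.ext (funext fun a => ?_)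
  have := congrFun (congrArg Subtype.val h) (τ a)
  simpa [relabel] using this

/-- Relabelling the vertices of one of the matchings. -/
def relabelAt (i : Fin l) (j : Fin c) (τ : Equiv.Perm (Fin m))
    (σ : Fin l → Fin c → PerfectMatching m) : Fin l → Fin c → PerfectMatching m :=
  fun i' j' => if i' = i ∧ j' = j then relabel τ (σ i' j') else σ i' j'

theorem relabelAt_injective (i : Fin l) (j : Fin c) (τ : Equiv.Perm (Fin m)) :
    Function.Injective (relabelAt i j τ) := by
  intro σ σ' h
  funext i' j'
  have := congrFun (congrFun h i') j'
  simp only [relabelAt] at this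
  split_ifs at this with h'
  · exact relabel_injective τ this
  · exact this

/-- `S` is the set of endpoints of `R` in the matching `(i, j)`; disjointness makes each edge
contribute exactly two. -/
theorem exists_touched {v : Fin N → Fin l × Fin m} (hv : Function.Injective v) (i : Fin l)
    (j : Fin c) (R : List (Edge N c)) (hR : IsMatchingList R)
    (hc : ∀ e ∈ R, (v e.1).1 = (v e.2.2).1) :
    ∃ S : Finset (Fin m),
      S.card = 2 * (R.map (edgeClass fun u => (v u).1)).count (i, j) ∧
      ∀ b, b ∈ S ↔ ∃ e ∈ R, ((v e.1).1 = i ∧ e.2.1 = j) ∧ (b = (v e.1).2 ∨ b = (v e.2.2).2) := by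
  induction R with
  | nil => exact ⟨∅, by simp, by simp⟩
  | cons e R ih =>
    rw [isMatchingList_cons] at hR
    rw [List.forall_mem_cons] at hc
    obtain ⟨S, hS, hmem⟩ := ih hR.2.2 hc.2
    by_cases he : (v e.1).1 = i ∧ e.2.1 = j
    · have hcount : ((e :: R).map (edgeClass fun u => (v u).1)).count (i, j)
          = (R.map (edgeClass fun u => (v u).1)).count (i, j) + 1 := by
        rw [List.map_cons, List.count_cons, if_pos]
        simp [edgeClass, he.1, he.2]
      have hne : ∀ {u u'}, u ≠ u' → (v u).1 = (v u').1 → (v u).2 ≠ (v u').2 := fun h h1 h2 =>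
        h (hv (Prod.ext h1 h2))
      have h1 : (v e.2.2).2 ∉ S := by
        rw [hmem]
        rintro ⟨e', he', ⟨hi, hj⟩, h⟩
        have hd := hR.1 e' he' (he.2.trans hj.symm)
        have hi' := hc.2 e' he'
        rcases h with h | h
        · exact hne hd.2.2.1 (hc.1.symm.trans (he.1.trans hi.symm)) h
        · exact hne hd.2.2.2 (hc.1.symm.trans (he.1.trans (hi.symm.trans hi'))) h
      have h2 : (v e.1).2 ∉ insert (v e.2.2).2 S := by
        rw [Finset.mem_insert, hmem]
        rintro (h | ⟨e', he', ⟨hi, hj⟩, h⟩)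
        · exact hne hR.2.1 hc.1 h
        have hd := hR.1 e' he' (he.2.trans hj.symm)
        have hi' := hc.2 e' he'
        rcases h with h | h
        · exact hne hd.1 (he.1.trans hi.symm) h
        · exact hne hd.2.1 (he.1.trans (hi.symm.trans hi')) h
      refine ⟨insert (v e.1).2 (insert (v e.2.2).2 S), ?_, fun b => ?_⟩
      · rw [Finset.card_insert_of_notMem h2, Finset.card_insert_of_notMem h1, hS, hcount]
        ring
      · simp only [Finset.mem_insert, hmem, List.mem_cons, or_and_right, exists_or, exists_eq_left,
          he, true_and, and_self, or_assoc]
    · refine ⟨S, ?_, fun b => ?_⟩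
      · rw [hS, List.map_cons, List.count_cons, if_neg]
        · simp
        · simpa [edgeClass] using he
      · simp only [hmem, List.mem_cons, or_and_right, exists_or, exists_eq_left, he, false_and,
          false_or]

-- Given `R`, the partner of `e.1` in its matching is equidistributed over the vertices other than
-- `e.1` that `R` leaves untouched there. If `R` has `k` edges in this matching, `m - (2k + 1)` such
-- vertices remain.
open Classical in
theorem card_contains_cons {v : Fin N → Fin l × Fin m} (hv : Function.Injective v) (e : Edge N c)
    (R : List (Edge N c)) (hR : IsMatchingList (e :: R)) (he : (v e.1).1 = (v e.2.2).1) :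
    ((Finset.univ.filter fun σ => Contains σ v (e :: R)).card : ℝ)
        * (m - (2 * ((R.map (edgeClass fun u => (v u).1)).count
            (edgeClass (fun u => (v u).1) e) : ℝ) + 1))
      = (Finset.univ.filter fun σ => Contains σ v R).card := by
  rw [isMatchingList_cons] at hR
  -- If nothing contains `R`, both sides vanish; otherwise a witness shows that the edges of `R`
  -- stay inside classes.
  rcases (Finset.univ.filter fun σ => Contains σ v R).eq_empty_or_nonempty with h0 | ⟨σ₀, h0⟩
  · have : (Finset.univ.filter fun σ => Contains σ v (e :: R)) = ∅ := by
      rw [Finset.eq_empty_iff_forall_notMem] at h0 ⊢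
      intro σ hσ
      refine h0 σ ?_
      simp only [Finset.mem_filter, Finset.mem_univ, true_and, contains_cons] at hσ ⊢
      exact hσ.2
    rw [h0, this]
    simp
  have hcl : ∀ e' ∈ R, (v e'.1).1 = (v e'.2.2).1 := by
    intro e' he'
    rw [Finset.mem_filter] at h0
    rw [h0.2 e' he']
  obtain ⟨S, hS, hmem⟩ := exists_touched hv (v e.1).1 e.2.1 R hR.2.2 hcl
  have hne : ∀ {u u'}, u ≠ u' → (v u).1 = (v u').1 → (v u).2 ≠ (v u').2 := fun h h1 h2 =>
    h (hv (Prod.ext h1 h2))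
  have haS : (v e.1).2 ∉ S := by
    rw [hmem]
    rintro ⟨e', he', ⟨hi, hj⟩, h | h⟩
    · exact hne (hR.1 e' he' hj.symm).1 hi.symm h
    · exact hne (hR.1 e' he' hj.symm).2.1 (hi.symm.trans (hcl e' he')) h
  have hbS : (v e.2.2).2 ∉ S := by
    rw [hmem]
    rintro ⟨e', he', ⟨hi, hj⟩, h | h⟩
    · exact hne (hR.1 e' he' hj.symm).2.2.1 (he.symm.trans hi.symm) h
    · exact hne (hR.1 e' he' hj.symm).2.2.2 (he.symm.trans (hi.symm.trans (hcl e' he'))) h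
  set T : Finset (Fin m) := Finset.univ \ insert (v e.1).2 S with hT
  have hTmem : ∀ b, b ∈ T ↔ b ≠ (v e.1).2 ∧ b ∉ S := by simp [hT]
  have hbT : (v e.2.2).2 ∈ T := (hTmem _).2 ⟨(hne hR.2.1 he).symm, hbS⟩
  have hTcard : (T.card : ℝ) = m - (2 * ((R.map (edgeClass fun u => (v u).1)).count
      (edgeClass (fun u => (v u).1) e) : ℝ) + 1) := by
    have h1 := Finset.card_sdiff_add_card_inter (Finset.univ : Finset (Fin m)) (insert (v e.1).2 S)
    rw [Finset.univ_inter, Finset.card_insert_of_notMem haS, hS, Finset.card_univ,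
      Fintype.card_fin, ← hT] at h1
    have h2 : (T.card : ℝ) + (2 * ((R.map (edgeClass fun u => (v u).1)).count
      ((v e.1).1, e.2.1) : ℝ) + 1) = m := by exact_mod_cast h1
    rw [edgeClass]
    linarith
  -- Touched vertices are matched among themselves, so the untouched `e.1` cannot have one as its
  -- partner.
  have hmaps : ∀ σ ∈ Finset.univ.filter fun σ => Contains σ v R,
      (σ (v e.1).1 e.2.1).1 (v e.1).2 ∈ T := by
    intro σ hσ
    simp only [Finset.mem_filter, Finset.mem_univ, true_and] at hσ
    rw [hTmem]
    refine ⟨((σ _ _).2 _).2, fun h => haS ?_⟩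
    rw [hmem] at h ⊢
    obtain ⟨e', he', ⟨hi, hj⟩, h⟩ := h
    refine ⟨e', he', ⟨hi, hj⟩, ?_⟩
    have h1 := congrArg Prod.snd (hσ e' he')
    simp only [hi, hj] at h1
    rw [← ((σ (v e.1).1 e.2.1).2 (v e.1).2).1]
    rcases h with h | h
    · right
      rw [h, h1]
    · left
      rw [h, h1, ((σ (v e.1).1 e.2.1).2 _).1]
  -- Conjugating this one matching by the transposition of `b` and `b'` preserves the edges of `R`
  -- and moves the partner from `b` to `b'`.
  have hfib : ∀ b ∈ T, ∀ b' ∈ T,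
      ((Finset.univ.filter fun σ => Contains σ v R).filter
        fun σ => (σ (v e.1).1 e.2.1).1 (v e.1).2 = b).card
      ≤ ((Finset.univ.filter fun σ => Contains σ v R).filter
        fun σ => (σ (v e.1).1 e.2.1).1 (v e.1).2 = b').card := by
    intro b hb b' hb'
    rw [hTmem] at hb hb'
    refine Finset.card_le_card_of_injOn (relabelAt (v e.1).1 e.2.1 (Equiv.swap b b')) ?_
      (relabelAt_injective _ _ _).injOn
    intro σ hσ
    simp only [Finset.coe_filter, Finset.mem_filter, Finset.mem_univ, true_and,
      Set.mem_ofPred_eq] at hσ ⊢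
    refine ⟨fun e' he' => ?_, ?_⟩
    · have h1 := hσ.1 e' he'
      by_cases h : (v e'.1).1 = (v e.1).1 ∧ e'.2.1 = e.2.1
      · have hfix : ∀ a, (a = (v e'.1).2 ∨ a = (v e'.2.2).2) → Equiv.swap b b' a = a := by
          intro a ha
          have haS : a ∈ S := (hmem a).2 ⟨e', he', h, ha⟩
          exact Equiv.swap_apply_of_ne_of_ne (fun h => hb.2 (h ▸ haS)) (fun h => hb'.2 (h ▸ haS))
        simp only [relabelAt, if_pos h, relabel, Equiv.symm_swap]
        rw [hfix _ (Or.inl rfl), hfix _ (Or.inr (congrArg Prod.snd h1).symm)]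
        exact h1
      · simp only [relabelAt, if_neg h]
        exact h1
    · simp only [relabelAt, and_self, if_true, relabel, Equiv.symm_swap]
      rw [Equiv.swap_apply_of_ne_of_ne hb.1.symm hb'.1.symm, hσ.2, Equiv.swap_apply_left]
  have hcons : (Finset.univ.filter fun σ => Contains σ v (e :: R))
      = (Finset.univ.filter fun σ => Contains σ v R).filter
        fun σ => (σ (v e.1).1 e.2.1).1 (v e.1).2 = (v e.2.2).2 := by
    ext σ
    simp only [Finset.mem_filter, Finset.mem_univ, true_and, contains_cons, Prod.ext_iff, he]
    exact ⟨fun h => ⟨h.2, h.1.symm⟩, fun h => ⟨h.2.symm, h.1⟩⟩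
  have hsum := Finset.card_eq_sum_card_fiberwise hmaps
  rw [Finset.sum_congr rfl fun b hb => le_antisymm (hfib b hb _ hbT) (hfib _ hbT b hb),
    Finset.sum_const, ← hcons, smul_eq_mul] at hsum
  rw [← hTcard, hsum]
  push_cast
  ring

open Classical in
theorem card_contains {v : Fin N → Fin l × Fin m} (hv : Function.Injective v) (hm : Even m)
    (R : List (Edge N c)) (hR : IsMatchingList R) :
    ((Finset.univ.filter fun σ => Contains σ v R).card : ℝ)
      = edgeWeight m (fun u => (v u).1) R
        * Fintype.card (Fin l → Fin c → PerfectMatching m) := by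
  induction R with
  | nil => simp [Contains, edgeWeight]
  | cons e R ih =>
    have hR' := (isMatchingList_cons.1 hR).2.2
    rw [edgeWeight]
    split_ifs with he
    · have h := card_contains_cons hv e R hR he
      -- The even number `m` cannot equal an odd one.
      have hne : (m - (2 * ((R.map (edgeClass fun u => (v u).1)).count
            (edgeClass (fun u => (v u).1) e) : ℝ) + 1)) ≠ 0 := by
        intro h0
        rw [sub_eq_zero] at h0
        have h1 : m = 2 * (R.map (edgeClass fun u => (v u).1)).count
          (edgeClass (fun u => (v u).1) e) + 1 := by exact_mod_cast h0
        rw [h1] at hm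
        exact Nat.not_even_bit1 _ hm
      rw [mul_one, mul_right_comm, ← ih hR', ← h, mul_assoc, mul_inv_cancel₀ hne, mul_one]
    · rw [mul_zero, zero_mul, zero_mul, Nat.cast_eq_zero, Finset.card_eq_zero,
        Finset.eq_empty_iff_forall_notMem]
      intro σ hσ
      rw [Finset.mem_filter, contains_cons] at hσ
      refine he ?_
      rw [hσ.2.1]

/-- Translation by half of `m` modulo `m` is a fixed-point-free involution. -/
theorem nonempty_perfectMatching (hm : Even m) : Nonempty (PerfectMatching m) := by
  obtain ⟨k, rfl⟩ := hm
  refine ⟨⟨fun a => ⟨if a.1 < k then a.1 + k else a.1 - k, by have := a.2; split_ifs <;> omega⟩,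
    fun a => ⟨?_, ?_⟩⟩⟩
  · have := a.2
    ext
    simp only
    split_ifs <;> omega
  · have := a.2
    intro h
    have := congrArg Fin.val h
    simp only at this
    split_ifs at this <;> omega

end Counting

/-! ### Averages over the assignments of vertices to classes -/

section Averages

/-- The functions that are constant on given pairs factor through a quotient. -/
theorem exists_quotient_of_pairs {V : Type} [Fintype V] [DecidableEq V] (H : List (V × V)) :
    ∃ (κ : Type) (_ : Fintype κ) (_ : DecidableEq κ) (π : V → κ), Function.Surjective π ∧
      Fintype.card V ≤ Fintype.card κ + H.length ∧
      ∀ (β : Type) (φ : V → β), (∀ p ∈ H, φ p.1 = φ p.2) ↔ ∃ ψ : κ → β, ψ ∘ π = φ := by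
  induction H with
  | nil => exact ⟨V, inferInstance, inferInstance, id, Function.surjective_id, by simp, by simp⟩
  | cons p H ih =>
    obtain ⟨κ, _, _, π, hπ, hcard, h⟩ := ih
    by_cases hp : π p.1 = π p.2
    · refine ⟨κ, inferInstance, inferInstance, π, hπ, hcard.trans (by simp), fun β φ => ?_⟩
      rw [List.forall_mem_cons, h]
      constructor
      · exact fun h => h.2
      · rintro ⟨ψ, rfl⟩
        exact ⟨congrArg ψ hp, ψ, rfl⟩
    -- A new pair joining two different blocks costs exactly one block: that of `p.2` is absorbed by
    -- that of `p.1`.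
    · let merge : κ → {x : κ // x ≠ π p.2} := fun x =>
        if hx : x = π p.2 then ⟨π p.1, hp⟩ else ⟨x, hx⟩
      have hmerge : ∀ x : {x : κ // x ≠ π p.2}, merge x = x := fun x => dif_neg x.2
      have hm1 : merge (π p.1) = ⟨π p.1, hp⟩ := dif_neg hp
      have hm2 : merge (π p.2) = ⟨π p.1, hp⟩ := dif_pos rfl
      refine ⟨{x : κ // x ≠ π p.2}, inferInstance, inferInstance, merge ∘ π,
        Function.Surjective.comp (fun x => ⟨x, hmerge x⟩) hπ, ?_, fun β φ => ?_⟩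
      · have : Fintype.card {x : κ // x ≠ π p.2} = Fintype.card κ - 1 := by
          simp
        rw [this, List.length_cons]
        omega
      · rw [List.forall_mem_cons, h]
        constructor
        · rintro ⟨h1, ψ, rfl⟩
          refine ⟨fun x => ψ x, funext fun u => ?_⟩
          simp only [Function.comp_apply] at h1 ⊢
          by_cases hu : π u = π p.2
          · rw [hu, hm2, ← h1]
          · rw [hmerge ⟨π u, hu⟩]
        · rintro ⟨ψ, rfl⟩
          refine ⟨?_, ψ ∘ merge, rfl⟩
          simp only [Function.comp_apply, hm1, hm2]

/-- The indicator of the assignments of vertices to classes that are constant on given pairs. -/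
def pairIndicator {N : ℕ} (H : List (Fin N × Fin N)) (l : ℕ) (φ : Fin N → Fin l) : ℝ :=
  if ∀ p ∈ H, φ p.1 = φ p.2 then 1 else 0

theorem pairIndicator_append {N : ℕ} (H H' : List (Fin N × Fin N)) (l : ℕ) (φ : Fin N → Fin l) :
    pairIndicator (H ++ H') l φ = pairIndicator H l φ * pairIndicator H' l φ := by
  simp only [pairIndicator, List.forall_mem_append, ite_and, ite_mul, one_mul, zero_mul]

theorem pairIndicator_nil {N : ℕ} (l : ℕ) (φ : Fin N → Fin l) : pairIndicator [] l φ = 1 := by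
  simp [pairIndicator]

theorem pairIndicator_cons {N : ℕ} (p : Fin N × Fin N) (H : List (Fin N × Fin N)) (l : ℕ)
    (φ : Fin N → Fin l) :
    pairIndicator (p :: H) l φ = pairIndicator H l φ * if φ p.1 = φ p.2 then 1 else 0 := by
  simp only [pairIndicator, List.forall_mem_cons, ite_and, mul_ite, mul_one, mul_zero]

/-- Here `k` is the number of blocks after identifying the pairs, hence independent of `l`; each
pair removes at most one block. -/
theorem exists_sum_pairIndicator {N : ℕ} (H : List (Fin N × Fin N)) :
    ∃ k, k ≤ N ∧ N ≤ k + H.length ∧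
      ∀ l, ∑ φ : Fin N → Fin l, pairIndicator H l φ = (l : ℝ) ^ k := by
  obtain ⟨κ, _, _, π, hπ, hcard, h⟩ := exists_quotient_of_pairs H
  rw [Fintype.card_fin] at hcard
  refine ⟨Fintype.card κ, by simpa using Fintype.card_le_of_surjective π hπ, hcard, fun l => ?_⟩
  have hset : (Finset.univ.filter fun φ : Fin N → Fin l => ∀ p ∈ H, φ p.1 = φ p.2)
      = Finset.univ.image fun ψ : κ → Fin l => ψ ∘ π := by
    ext φ
    rw [Finset.mem_filter, h]
    simp
  simp only [pairIndicator, Finset.sum_boole]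
  rw [hset, Finset.card_image_of_injective _ hπ.injective_comp_right, Finset.card_univ]
  simp

/-- The span of the indicators of at most `n` coincidences, uniformly in the number of classes. -/
def pairSpan (N n : ℕ) : Submodule ℝ ((l : ℕ) → (Fin N → Fin l) → ℝ) :=
  Submodule.span ℝ (pairIndicator '' {H | H.length ≤ n})

theorem mul_mem_pairSpan {N n n' : ℕ} {F G : (l : ℕ) → (Fin N → Fin l) → ℝ}
    (hF : F ∈ pairSpan N n) (hG : G ∈ pairSpan N n') : F * G ∈ pairSpan N (n + n') := by
  have h : pairSpan N n * pairSpan N n' ≤ pairSpan N (n + n') := by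
    rw [pairSpan, pairSpan, Submodule.span_mul_span]
    refine Submodule.span_mono ?_
    rintro _ ⟨_, ⟨H, hH, rfl⟩, _, ⟨H', hH', rfl⟩, rfl⟩
    refine ⟨H ++ H', ?_, ?_⟩
    · simp only [Set.mem_ofPred_eq, List.length_append] at hH hH' ⊢
      omega
    · funext l φ
      exact pairIndicator_append H H' l φ
  exact h (Submodule.mul_mem_mul hF hG)

theorem const_mem_pairSpan (N n : ℕ) (r : ℝ) : (fun _ _ => r) ∈ pairSpan N n := by
  have h : (fun _ _ => r : (l : ℕ) → (Fin N → Fin l) → ℝ) = r • pairIndicator [] := by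
    funext l φ
    simp [pairIndicator_nil]
  rw [h]
  exact Submodule.smul_mem _ _ (Submodule.subset_span ⟨[], by simp, rfl⟩)

theorem pairIndicator_mem_pairSpan {N : ℕ} (H : List (Fin N × Fin N)) :
    pairIndicator H ∈ pairSpan N H.length :=
  Submodule.subset_span ⟨H, le_refl H.length, rfl⟩

/-- By linearity it suffices to treat indicators, whose averages are `l ^ (k - N)` with `N - k` at
most the number of pairs. The coefficients in `pairSpan` do not depend on `l`, so one `q` serves all
`l`. -/
theorem exists_average_eq_polynomial {N n : ℕ} (H : List (Fin N × Fin N))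
    {F : (l : ℕ) → (Fin N → Fin l) → ℝ} (hF : F ∈ pairSpan N n) :
    ∃ q : Polynomial ℝ, q.natDegree ≤ n + H.length ∧ ∀ l : ℕ, 0 < l →
      (l : ℝ) ^ (n + H.length) * ((∑ φ, pairIndicator H l φ * F l φ) / (l : ℝ) ^ N)
        = q.eval (l : ℝ) := by
  induction hF using Submodule.span_induction with
  | mem F hF =>
    obtain ⟨H', hH', rfl⟩ := hF
    simp only [Set.mem_ofPred_eq] at hH'
    obtain ⟨k, hk, hk', h⟩ := exists_sum_pairIndicator (H ++ H')
    rw [List.length_append] at hk'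
    refine ⟨Polynomial.X ^ (n + H.length + k - N), ?_, fun l hl => ?_⟩
    · rw [Polynomial.natDegree_X_pow]
      omega
    · simp only [← pairIndicator_append, h, Polynomial.eval_pow, Polynomial.eval_X]
      have hl' : (l : ℝ) ≠ 0 := by positivity
      rw [← mul_div_assoc, div_eq_iff (pow_ne_zero _ hl'), ← pow_add, ← pow_add]
      congr 1
      omega
  | zero => exact ⟨0, by simp, by simp⟩
  | add F G _ _ hF hG =>
    obtain ⟨p, hp, hp'⟩ := hF
    obtain ⟨q, hq, hq'⟩ := hG
    refine ⟨p + q, Polynomial.natDegree_add_le_of_degree_le hp hq, fun l hl => ?_⟩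
    rw [Polynomial.eval_add, ← hp' l hl, ← hq' l hl, ← mul_add, ← add_div,
      ← Finset.sum_add_distrib]
    simp only [Pi.add_apply, mul_add]
  | smul r F _ hF =>
    obtain ⟨p, hp, hp'⟩ := hF
    refine ⟨Polynomial.C r * p, (Polynomial.natDegree_C_mul_le _ _).trans hp, fun l hl => ?_⟩
    rw [Polynomial.eval_mul, Polynomial.eval_C, ← hp' l hl]
    simp only [Pi.smul_apply, smul_eq_mul, mul_left_comm _ r, ← Finset.mul_sum, mul_div_assoc]

/-- The count is the sum of the coincidences `φ e'.1 = φ e.1` over the edges `e'` of `R` with the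
label of `e`. -/
theorem count_mem_pairSpan {N c : ℕ} (e : Edge N c) (R : List (Edge N c)) :
    (fun (l : ℕ) (φ : Fin N → Fin l) =>
      ((R.map (edgeClass φ)).count (edgeClass φ e) : ℝ)) ∈ pairSpan N 1 := by
  induction R with
  | nil => simpa using const_mem_pairSpan N 1 0
  | cons e' R ih =>
    have h : (fun (l : ℕ) (φ : Fin N → Fin l) =>
        (((e' :: R).map (edgeClass φ)).count (edgeClass φ e) : ℝ))
        = (fun (l : ℕ) (φ : Fin N → Fin l) =>
            ((R.map (edgeClass φ)).count (edgeClass φ e) : ℝ))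
          + (if e'.2.1 = e.2.1 then (1 : ℝ) else 0) • pairIndicator [(e'.1, e.1)] := by
      funext l φ
      rw [List.map_cons, List.count_cons]
      simp only [Pi.add_apply, Pi.smul_apply, smul_eq_mul, pairIndicator, List.forall_mem_singleton,
        edgeClass, beq_iff_eq, Prod.mk.injEq, Nat.cast_add, Nat.cast_ite, Nat.cast_one,
        Nat.cast_zero]
      split_ifs <;> simp_all
    rw [h]
    have h1 : pairIndicator [(e'.1, e.1)] ∈ pairSpan N 1 := pairIndicator_mem_pairSpan [_]
    exact (pairSpan N 1).add_mem ih ((pairSpan N 1).smul_mem _ h1)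

end Averages

/-! ### The common denominator -/

section Denominator

open Polynomial

variable {Γ : Type} [Fintype Γ] [BEq Γ]

/-- The number of elements that occur at least `k` times in a list. -/
def multCount (k : ℕ) (s : List Γ) : ℕ := (Finset.univ.filter fun γ => k ≤ s.count γ).card

theorem multCount_nil {k : ℕ} (hk : 1 ≤ k) : multCount k ([] : List Γ) = 0 := by
  simp [multCount]
  omega

/-- The part of `∏ k ≤ D, (1 - (2 k - 1) X) ^ (D / k)` that is left over by the factors belonging
to a list. -/
noncomputable def leftover (D : ℕ) (s : List Γ) : ℝ[X] :=
  ∏ k ∈ Finset.Icc 1 D, (1 - C (2 * (k : ℝ) - 1) * X) ^ (D / k - multCount k s)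

theorem leftover_nil (D : ℕ) : leftover D ([] : List Γ)
    = ∏ k ∈ Finset.Icc 1 D, (1 - C (2 * (k : ℝ) - 1) * X) ^ (D / k) := by
  refine Finset.prod_congr rfl fun k hk => ?_
  rw [multCount_nil (Finset.mem_Icc.1 hk).1, Nat.sub_zero]

/-- The polynomial `∏ k ≤ D, (M - (2 k - 1) l) ^ (D / k)`. -/
noncomputable def denominator (D : ℕ) : MvPolynomial (Fin 2) ℝ :=
  ∏ k ∈ Finset.Icc 1 D, linFactor k ^ (D / k)

theorem eval_linFactor (M l : ℝ) (k : ℕ) :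
    MvPolynomial.eval ![M, l] (linFactor k) = M - (2 * k - 1) * l := by
  simp [linFactor]

theorem eval_denominator (D : ℕ) {M : ℝ} (l : ℝ) (hM : M ≠ 0) :
    MvPolynomial.eval ![M, l] (denominator D)
      = M ^ (∑ k ∈ Finset.Icc 1 D, D / k) * (leftover D ([] : List Γ)).eval (l / M) := by
  rw [leftover_nil, denominator, map_prod, eval_prod, ← Finset.prod_pow_eq_pow_sum,
    ← Finset.prod_mul_distrib]
  refine Finset.prod_congr rfl fun k _ => ?_
  rw [map_pow, eval_linFactor, eval_pow, ← mul_pow]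
  congr 1
  simp only [eval_sub, eval_one, eval_mul, eval_C, eval_X]
  field_simp

variable [LawfulBEq Γ]

/-- Markov's inequality for multiplicities; this is the source of the exponents `D / k`. -/
theorem mul_multCount_le (k : ℕ) (s : List Γ) : k * multCount k s ≤ s.length := by
  have h1 : ∑ γ, s.count γ = s.length := by
    classical
    induction s with
    | nil => simp
    | cons a s ih => simp [List.count_cons, Finset.sum_add_distrib, ih]
  rw [← h1, multCount, mul_comm, ← smul_eq_mul, ← Finset.sum_const]
  refine (Finset.sum_le_sum fun γ hγ => (Finset.mem_filter.1 hγ).2).trans ?_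
  exact Finset.sum_le_sum_of_subset (Finset.filter_subset _ _)

theorem multCount_cons (k : ℕ) (γ : Γ) (s : List Γ) :
    multCount k (γ :: s) = multCount k s + if k = s.count γ + 1 then 1 else 0 := by
  classical
  simp only [multCount]
  split_ifs with hk
  · have : (Finset.univ.filter fun γ' => k ≤ (γ :: s).count γ')
        = insert γ (Finset.univ.filter fun γ' => k ≤ s.count γ') := by
      ext γ'
      simp only [Finset.mem_filter, Finset.mem_univ, true_and, Finset.mem_insert, List.count_cons,
        beq_iff_eq]
      by_cases h : γ = γ'
      · subst h
        simp [hk]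
      · simp [h, Ne.symm h]
    rw [this, Finset.card_insert_of_notMem]
    simp [hk]
  · rw [add_zero]
    congr 1
    ext γ'
    simp only [Finset.mem_filter, Finset.mem_univ, true_and, List.count_cons, beq_iff_eq]
    split_ifs with h
    · subst h
      omega
    · rfl

/-- Prepending `γ` changes `multCount k` only at `k = s.count γ + 1`, and so uses up one factor with
`2k - 1 = 2 * s.count γ + 1`. The length bound keeps the exponent subtraction from truncating. -/
theorem leftover_eq_mul {D : ℕ} (γ : Γ) (s : List Γ) (h : (γ :: s).length ≤ D) :
    leftover D s = (1 - C (2 * (s.count γ : ℝ) + 1) * X) * leftover D (γ :: s) := by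
  have hmem : s.count γ + 1 ∈ Finset.Icc 1 D := by
    have := List.count_le_length (a := γ) (l := s)
    rw [List.length_cons] at h
    rw [Finset.mem_Icc]
    omega
  rw [leftover, leftover, ← Finset.mul_prod_erase _ _ hmem, ← Finset.mul_prod_erase _ _ hmem,
    ← mul_assoc]
  congr 1
  · have h1 : multCount (s.count γ + 1) (γ :: s) ≤ D / (s.count γ + 1) := by
      rw [Nat.le_div_iff_mul_le (Nat.succ_pos _), mul_comm]
      exact (mul_multCount_le _ _).trans h
    rw [multCount_cons, if_pos rfl] at h1 ⊢
    have h2 : D / (s.count γ + 1) - multCount (s.count γ + 1) s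
        = D / (s.count γ + 1) - (multCount (s.count γ + 1) s + 1) + 1 := by omega
    have h3 : (2 * ((s.count γ + 1 : ℕ) : ℝ) - 1) = 2 * (s.count γ : ℝ) + 1 := by
      push_cast
      ring
    rw [h2, pow_succ', h3]
  · refine Finset.prod_congr rfl fun k hk => ?_
    rw [multCount_cons, if_neg (Finset.ne_of_mem_erase hk), add_zero]

/-- Each element of the list uses up one factor of degree exactly one. -/
theorem natDegree_leftover_add_length_le {D : ℕ} (s : List Γ) (h : s.length ≤ D) :
    (leftover D s).natDegree + s.length ≤ ∑ k ∈ Finset.Icc 1 D, D / k := by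
  have hlin : ∀ a : ℝ, (1 - C a * X : ℝ[X]) ≠ 0 := fun a h0 => by
    simpa using congrArg (eval 0) h0
  induction s with
  | nil =>
    rw [leftover_nil, List.length_nil, add_zero]
    refine (natDegree_prod_le _ _).trans (Finset.sum_le_sum fun k _ => ?_)
    refine natDegree_pow_le.trans ?_
    refine (Nat.mul_le_mul_left _ ?_).trans (mul_one _).le
    compute_degree
  | cons γ s ih =>
    have h1 := ih ((Nat.le_succ _).trans h)
    have hne : leftover D (γ :: s) ≠ 0 :=
      Finset.prod_ne_zero_iff.2 fun k _ => pow_ne_zero _ (hlin _)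
    have hdeg : (1 - C (2 * (s.count γ : ℝ) + 1) * X : ℝ[X]).natDegree = 1 := by
      compute_degree!
      omega
    rw [leftover_eq_mul γ s h, natDegree_mul (hlin _) hne, hdeg] at h1
    rw [List.length_cons]
    omega

/-- Adding an edge divides by `1 - (2a + 1) X`, where the count `a` has degree one in coincidences.
The new coefficients `c` thus arise from the old ones `b` by `c (n + 1) = b (n + 1) + (2a + 1) c n`,
which raises the number of coincidences by one per step. -/
theorem coeff_leftover_mem_pairSpan {N c D : ℕ} (R : List (Edge N c)) (hR : R.length ≤ D) (n : ℕ) :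
    (fun (l : ℕ) (φ : Fin N → Fin l) => (leftover D (R.map (edgeClass φ))).coeff n)
      ∈ pairSpan N n := by
  induction R generalizing n with
  | nil =>
    simp only [List.map_nil, leftover_nil]
    exact const_mem_pairSpan N n _
  | cons e R ih =>
    have ih := ih ((Nat.le_succ _).trans hR)
    have h : ∀ (l : ℕ) (φ : Fin N → Fin l), leftover D (R.map (edgeClass φ))
        = (1 - C (2 * ((R.map (edgeClass φ)).count (edgeClass φ e) : ℝ) + 1) * X)
          * leftover D ((e :: R).map (edgeClass φ)) := fun l φ =>
      leftover_eq_mul _ _ (by simpa using hR)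
    induction n with
    | zero =>
      have h0 : ∀ (l : ℕ) (φ : Fin N → Fin l), (leftover D ((e :: R).map (edgeClass φ))).coeff 0
          = (leftover D (R.map (edgeClass φ))).coeff 0 := by
        intro l φ
        rw [h l φ, mul_coeff_zero]
        simp
      simp only [h0]
      exact ih 0
    | succ n ihn =>
      have h2 : (fun (l : ℕ) (φ : Fin N → Fin l) =>
            (leftover D ((e :: R).map (edgeClass φ))).coeff (n + 1))
          = (fun (l : ℕ) (φ : Fin N → Fin l) => (leftover D (R.map (edgeClass φ))).coeff (n + 1))
            + ((fun (l : ℕ) (φ : Fin N → Fin l) => (leftover D ((e :: R).map (edgeClass φ))).coeff n)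
              * ((2 : ℝ) • (fun (l : ℕ) (φ : Fin N → Fin l) =>
                  ((R.map (edgeClass φ)).count (edgeClass φ e) : ℝ)) + fun _ _ => 1)) := by
        funext l φ
        simp only [Pi.add_apply, Pi.mul_apply, Pi.smul_apply, smul_eq_mul]
        rw [h l φ, sub_mul, one_mul, coeff_sub, mul_assoc, coeff_C_mul, coeff_X_mul]
        ring
      rw [h2]
      exact (pairSpan N (n + 1)).add_mem (ih (n + 1)) (mul_mem_pairSpan ihn
        ((pairSpan N 1).add_mem ((pairSpan N 1).smul_mem 2 (count_mem_pairSpan e R))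
          (const_mem_pairSpan N 1 1)))

/-- With `μ = ε⁻¹`, each factor `(μ - (2a + 1))⁻¹` is `ε / (1 - (2a + 1) ε)`, whose denominator is
the factor split off from `leftover`. -/
theorem edgeWeight_mul_eval {N c D l : ℕ} (φ : Fin N → Fin l) (R : List (Edge N c))
    (hR : R.length ≤ D) {ε : ℝ} (hε : 0 < ε)
    (hD : ∀ k ∈ Finset.Icc 1 D, 1 - (2 * (k : ℝ) - 1) * ε ≠ 0) :
    edgeWeight ε⁻¹ φ R * (leftover D ([] : List (Fin l × Fin c))).eval ε
      = pairIndicator (R.map fun e => (e.1, e.2.2)) l φ * ε ^ R.length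
        * (leftover D (R.map (edgeClass φ))).eval ε := by
  induction R with
  | nil => simp [edgeWeight, pairIndicator_nil]
  | cons e R ih =>
    have ih := ih ((Nat.le_succ _).trans hR)
    rw [edgeWeight, mul_right_comm, mul_right_comm (edgeWeight _ _ _), ih, List.map_cons,
      pairIndicator_cons, List.map_cons, leftover_eq_mul (edgeClass φ e) _ (by simpa using hR),
      List.length_cons, pow_succ, eval_mul]
    set a := ((R.map (edgeClass φ)).count (edgeClass φ e) : ℝ) with ha
    have hne : 1 - (2 * a + 1) * ε ≠ 0 := by
      have h1 := hD ((R.map (edgeClass φ)).count (edgeClass φ e) + 1) (by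
        have := List.count_le_length (a := edgeClass φ e) (l := R.map (edgeClass φ))
        rw [List.length_map] at this
        rw [List.length_cons] at hR
        rw [Finset.mem_Icc]
        omega)
      push_cast at h1
      convert h1 using 3
      ring
    have hinv : (ε⁻¹ - (2 * a + 1))⁻¹ = ε / (1 - (2 * a + 1) * ε) := by
      rw [← inv_div]
      congr 1
      field_simp
    have heval : (1 - C (2 * a + 1) * X : ℝ[X]).eval ε = 1 - (2 * a + 1) * ε := by simp
    rw [hinv, heval]
    field_simp

theorem totalDegree_denominator_le (D : ℕ) :
    (denominator D).totalDegree ≤ ∑ k ∈ Finset.Icc 1 D, D / k := by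
  refine (MvPolynomial.totalDegree_finsetProd _ _).trans (Finset.sum_le_sum fun k _ => ?_)
  refine (MvPolynomial.totalDegree_pow _ _).trans ?_
  refine (Nat.mul_le_mul_left _ ?_).trans (mul_one _).le
  refine (MvPolynomial.totalDegree_sub _ _).trans (max_le (MvPolynomial.totalDegree_X _).le ?_)
  refine (MvPolynomial.totalDegree_mul _ _).trans ?_
  rw [MvPolynomial.totalDegree_C, MvPolynomial.totalDegree_X, zero_add]

theorem totalDegree_aeval_X_le (i : Fin 2) (q : ℝ[X]) :
    (aeval (MvPolynomial.X i : MvPolynomial (Fin 2) ℝ) q).totalDegree ≤ q.natDegree := by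
  rw [aeval_eq_sum_range]
  refine MvPolynomial.totalDegree_finsetSum_le fun n hn => ?_
  refine (MvPolynomial.totalDegree_smul_le _ _).trans ?_
  rw [MvPolynomial.totalDegree_X_pow]
  exact Nat.lt_succ_iff.1 (Finset.mem_range.1 hn)

/-- The average of the weights over all assignments of vertices to classes is a rational function
with the common denominator. -/
theorem exists_numerator {N c D : ℕ} (R : List (Edge N c)) (hR : R.length ≤ D) :
    ∃ f : MvPolynomial (Fin 2) ℝ, f.totalDegree ≤ ∑ k ∈ Finset.Icc 1 D, D / k ∧
      ∀ (M : ℝ) (l : ℕ), 0 < M → 0 < l →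
        (∀ k ∈ Finset.Icc 1 D, M - (2 * (k : ℝ) - 1) * l ≠ 0) →
        MvPolynomial.eval ![M, (l : ℝ)] f = MvPolynomial.eval ![M, (l : ℝ)] (denominator D)
          * ((∑ φ : Fin N → Fin l, edgeWeight (M / l) φ R) / (l : ℝ) ^ N) := by
  set d := ∑ k ∈ Finset.Icc 1 D, D / k with hd
  set H := R.map fun e : Edge N c => (e.1, e.2.2) with hH
  have hlen : H.length = R.length := by simp [hH]
  choose q hq hq' using fun n => exists_average_eq_polynomial H (coeff_leftover_mem_pairSpan R hR n)
  -- Any class assignment yields this bound; the identity, with `l = N`, is always available.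
  have hRd : R.length ≤ d := by
    have := natDegree_leftover_add_length_le (R.map (edgeClass (l := N) id)) (D := D)
      (by simpa using hR)
    rw [List.length_map] at this
    omega
  -- The denominator supplies `M ^ d`, of which `(l / M) ^ (R.length + n)` uses up `M ^ (R.length +
  -- n)`; its power of `l` turns the averaged coefficient into `q n`.
  refine ⟨∑ n ∈ Finset.range (d - R.length + 1), MvPolynomial.X 0 ^ (d - R.length - n)
    * aeval (MvPolynomial.X 1 : MvPolynomial (Fin 2) ℝ) (q n), ?_, fun M l hM hl hne => ?_⟩
  · refine MvPolynomial.totalDegree_finsetSum_le fun n hn => ?_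
    refine (MvPolynomial.totalDegree_mul _ _).trans ?_
    rw [MvPolynomial.totalDegree_X_pow]
    have h1 := (totalDegree_aeval_X_le 1 (q n)).trans (hq n)
    have h2 := Finset.mem_range.1 hn
    omega
  have hl' : (0 : ℝ) < l := by exact_mod_cast hl
  have hε : 0 < l / M := by positivity
  have hD : ∀ k ∈ Finset.Icc 1 D, 1 - (2 * (k : ℝ) - 1) * (l / M) ≠ 0 := by
    intro k hk h0
    refine hne k hk ?_
    field_simp at h0
    linarith
  have hterm : ∀ φ : Fin N → Fin l,
      MvPolynomial.eval ![M, (l : ℝ)] (denominator D) * edgeWeight (M / l) φ R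
        = ∑ n ∈ Finset.range (d - R.length + 1), M ^ (d - R.length - n)
          * ((l : ℝ) ^ (n + H.length)
            * (pairIndicator H l φ * (leftover D (R.map (edgeClass φ))).coeff n)) := by
    intro φ
    have h1 := natDegree_leftover_add_length_le (R.map (edgeClass φ)) (D := D) (by simpa using hR)
    rw [List.length_map, ← hd] at h1
    rw [eval_denominator (Γ := Fin l × Fin c) D l hM.ne', mul_assoc, mul_comm (eval _ _), ← inv_div,
      edgeWeight_mul_eval φ R hR hε hD, eval_eq_sum_range' (n := d - R.length + 1) (by omega),
      ← hH, ← hd, Finset.mul_sum, Finset.mul_sum]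
    refine Finset.sum_congr rfl fun n hn => ?_
    have h2 := Finset.mem_range.1 hn
    have h3 : M ^ d = M ^ (d - R.length - n) * M ^ n * M ^ R.length := by
      rw [← pow_add, ← pow_add]
      congr 1
      omega
    rw [h3, hlen, div_pow, div_pow, pow_add]
    field_simp
  rw [map_sum, ← mul_div_assoc, Finset.mul_sum, Finset.sum_congr rfl fun φ _ => hterm φ,
    Finset.sum_comm, Finset.sum_div]
  refine Finset.sum_congr rfl fun n _ => ?_
  rw [map_mul, map_pow, MvPolynomial.eval_X, ← Finset.mul_sum, ← Finset.mul_sum, mul_div_assoc,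
    mul_div_assoc, hq' n l hl]
  congr 1
  rw [← MvPolynomial.aeval_eq_eval, ← Polynomial.aeval_algHom_apply]
  simp

end Denominator

/-! ### Tail bounds -/

-- Union bound over the classes and Markov's inequality for `exp (t * size)`, whose sum over all
-- assignments factors over the vertices.
open Classical in
theorem card_not_fits_le {l n m : ℕ} {t : ℝ} (ht : 0 ≤ t) :
    ((Finset.univ.filter fun φ : Fin n → Fin l => ¬ Fits m φ).card : ℝ)
      ≤ l * (Real.exp (-(t * m)) * (l + (Real.exp t - 1)) ^ n) := by
  have h1 : ∀ i : Fin l, ∑ φ : Fin n → Fin l,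
      Real.exp (t * (Finset.univ.filter fun u => φ u = i).card) = (l + (Real.exp t - 1)) ^ n := by
    intro i
    have h2 : ∑ j : Fin l, (if j = i then Real.exp t else 1) = l + (Real.exp t - 1) := by
      have : ∀ j : Fin l, (if j = i then Real.exp t else 1)
          = 1 + if j = i then Real.exp t - 1 else 0 := by
        intro j
        split_ifs <;> ring
      simp [this, Finset.sum_add_distrib]
    rw [← h2, Fintype.sum_pow]
    refine Finset.sum_congr rfl fun φ _ => ?_
    rw [Finset.prod_ite, Finset.prod_const, Finset.prod_const_one, mul_one, ← Real.exp_nat_mul,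
      mul_comm]
  have h3 : ∀ φ : Fin n → Fin l, (if ¬ Fits m φ then (1 : ℝ) else 0)
      ≤ ∑ i, Real.exp (-(t * m)) * Real.exp (t * (Finset.univ.filter fun u => φ u = i).card) := by
    intro φ
    split_ifs with h
    · exact Finset.sum_nonneg fun i _ => by positivity
    · simp only [Fits, not_forall, not_le] at h
      obtain ⟨i, hi⟩ := h
      refine le_trans ?_ (Finset.single_le_sum (fun i _ => by positivity) (Finset.mem_univ i))
      rw [← Real.exp_add, Real.one_le_exp_iff]
      have : (m : ℝ) ≤ (Finset.univ.filter fun u => φ u = i).card := by exact_mod_cast hi.le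
      nlinarith
  rw [← Finset.sum_boole]
  refine (Finset.sum_le_sum fun φ _ => h3 φ).trans (le_of_eq ?_)
  rw [Finset.sum_comm]
  simp [← Finset.mul_sum, h1]

open Classical in
/-- A Chernoff bound for the probability that some class is chosen too often. -/
theorem card_not_fits_div_le {l n m : ℕ} (hl : 0 < l) {δ : ℝ} (hδ : 0 ≤ δ) (hδ' : δ ≤ 2)
    (hm : (1 + δ) * n ≤ m * l) :
    ((Finset.univ.filter fun φ : Fin n → Fin l => ¬ Fits m φ).card : ℝ) / (l : ℝ) ^ n
      ≤ l * Real.exp (-(n / l * δ ^ 2 / 4)) := by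
  have hl' : (0 : ℝ) < l := by exact_mod_cast hl
  -- The exponential moment is taken at `t = δ / 2`; this quadratic bound needs `δ / 2 ≤ 1`.
  have hexp : Real.exp (δ / 2) - 1 ≤ δ / 2 + (δ / 2) ^ 2 := by
    have := Real.abs_exp_sub_one_sub_id_le (x := δ / 2) (by rw [abs_of_nonneg] <;> linarith)
    linarith [(abs_le.1 this).2]
  have hexp0 : 0 ≤ Real.exp (δ / 2) - 1 := by
    linarith [Real.one_le_exp (show 0 ≤ δ / 2 by linarith)]
  rw [div_le_iff₀ (by positivity)]
  refine (card_not_fits_le (t := δ / 2) (by linarith)).trans ?_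
  have h1 : (l : ℝ) + (Real.exp (δ / 2) - 1) ≤ l * Real.exp ((δ / 2 + (δ / 2) ^ 2) / l) := by
    have := Real.add_one_le_exp ((δ / 2 + (δ / 2) ^ 2) / l)
    calc (l : ℝ) + (Real.exp (δ / 2) - 1) ≤ l + (δ / 2 + (δ / 2) ^ 2) := by linarith
      _ = l * ((δ / 2 + (δ / 2) ^ 2) / l + 1) := by field_simp; ring
      _ ≤ _ := by gcongr
  rw [mul_assoc]
  refine mul_le_mul_of_nonneg_left ?_ hl'.le
  calc Real.exp (-(δ / 2 * m)) * ((l : ℝ) + (Real.exp (δ / 2) - 1)) ^ n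
      ≤ Real.exp (-(δ / 2 * m)) * (l * Real.exp ((δ / 2 + (δ / 2) ^ 2) / l)) ^ n := by gcongr
    _ = Real.exp (-(δ / 2 * m) + n * ((δ / 2 + (δ / 2) ^ 2) / l)) * (l : ℝ) ^ n := by
        rw [mul_pow, ← Real.exp_nat_mul, Real.exp_add]
        ring
    _ ≤ Real.exp (-(n / l * δ ^ 2 / 4)) * (l : ℝ) ^ n := by
        gcongr
        have h2 : (1 + δ) * n / l ≤ m := by
          rw [div_le_iff₀ hl']
          exact hm
        have h3 : δ / 2 * ((1 + δ) * n / l) ≤ δ / 2 * m := by gcongr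
        have h4 : δ / 2 * ((1 + δ) * n / l) - n * ((δ / 2 + (δ / 2) ^ 2) / l)
            = n / l * δ ^ 2 / 4 := by
          field_simp
          ring
        linarith

/-! ### Acceptance probabilities as averages over the classes -/

/-- Needed also for overflowing assignments, where the weight is only a formula and not a
probability. -/
theorem edgeWeight_mem_Icc {N c l D : ℕ} {μ : ℝ}
    (hμ : ∀ k ∈ Finset.Icc 1 D, 1 ≤ μ - (2 * (k : ℝ) - 1)) (φ : Fin N → Fin l)
    (R : List (Edge N c)) (hR : R.length ≤ D) : edgeWeight μ φ R ∈ Set.Icc (0 : ℝ) 1 := by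
  induction R with
  | nil => simp [edgeWeight]
  | cons e R ih =>
    obtain ⟨h0, h1⟩ := ih ((Nat.le_succ _).trans hR)
    have h2 := hμ ((R.map (edgeClass φ)).count (edgeClass φ e) + 1) (by
      have := List.count_le_length (a := edgeClass φ e) (l := R.map (edgeClass φ))
      rw [List.length_map] at this
      rw [List.length_cons] at hR
      rw [Finset.mem_Icc]
      omega)
    have h3 : 1 ≤ μ - (2 * ((R.map (edgeClass φ)).count (edgeClass φ e) : ℝ) + 1) := by
      push_cast at h2
      linarith
    have h4 := inv_le_one_of_one_le₀ h3
    have h5 : 0 ≤ (μ - (2 * ((R.map (edgeClass φ)).count (edgeClass φ e) : ℝ) + 1))⁻¹ := by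
      rw [inv_nonneg]
      linarith
    rw [edgeWeight]
    split_ifs
    · rw [mul_one]
      exact ⟨mul_nonneg h0 h5, mul_le_one₀ h1 h5 h4⟩
    · simp

open Classical in
/-- The probability that all edges of a list are present, given the classes of the vertices. -/
theorem exists_sat_weight {N c D : ℕ} (L : List (Edge N c)) (hL : L.length ≤ D) :
    ∃ (W : (l : ℕ) → ℝ → (Fin N → Fin l) → ℝ) (f : MvPolynomial (Fin 2) ℝ),
      f.totalDegree ≤ ∑ k ∈ Finset.Icc 1 D, D / k ∧
      (∀ l μ φ, (∀ k ∈ Finset.Icc 1 D, 1 ≤ μ - (2 * (k : ℝ) - 1)) → |W l μ φ| ≤ 1) ∧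
      (∀ (l m : ℕ), Even m → ∀ v : Fin N → Fin l × Fin m, Function.Injective v →
        ∑ σ : Fin l → Fin c → PerfectMatching m,
            (if Sat (inducedInput σ v) L then (1 : ℝ) else 0)
          = W l m (fun u => (v u).1) * Fintype.card (Fin l → Fin c → PerfectMatching m)) ∧
      ∀ (M : ℝ) (l : ℕ), 0 < M → 0 < l →
        (∀ k ∈ Finset.Icc 1 D, M - (2 * (k : ℝ) - 1) * l ≠ 0) →
        MvPolynomial.eval ![M, (l : ℝ)] f = MvPolynomial.eval ![M, (l : ℝ)] (denominator D)
          * ((∑ φ : Fin N → Fin l, W l (M / l) φ) / (l : ℝ) ^ N) := by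
  rcases exists_isMatchingList L with h | ⟨R, hR, hlen, h⟩
  · refine ⟨fun _ _ _ => 0, 0, by simp, by simp, fun l m _ v hv => ?_, by simp⟩
    rw [zero_mul]
    exact Finset.sum_eq_zero fun σ _ => if_neg (h _ (isMatchingInput_inducedInput hv))
  · obtain ⟨f, hf, hf'⟩ := exists_numerator R (hlen.trans hL)
    refine ⟨fun l μ φ => edgeWeight μ φ R, f, hf, fun l μ φ hμ => ?_, fun l m hm v hv => ?_, hf'⟩
    · have := edgeWeight_mem_Icc hμ φ R (hlen.trans hL)
      exact abs_le.2 ⟨by linarith [this.1], this.2⟩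
    · rw [← card_contains hv hm R hR, Finset.sum_boole]
      simp only [h _ (isMatchingInput_inducedInput hv), sat_inducedInput hv]

-- Matchings and vertices are chosen independently, so one may average over the matchings first;
-- what remains depends on the classes alone.
open Classical in
theorem acceptProb_eq_sum {N c T M l : ℕ} (A : QueryAlgorithm N c T) (hl : 0 < l)
    (hm : Even (M / l)) (ρ : ℝ) (G : (Fin N → Fin l) → ℝ)
    (hG : ∀ v : Fin N → Fin l × Fin (M / l), Function.Injective v →
      ∑ σ : Fin l → Fin c → PerfectMatching (M / l), A.acceptProbOn (inducedInput σ v)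
        = G (fun u => (v u).1) * Fintype.card (Fin l → Fin c → PerfectMatching (M / l))) :
    acceptProb A M l ρ = (∑ φ, if Fits (M / l) φ then G φ else ρ) / (l : ℝ) ^ N := by
  have := nonempty_perfectMatching hm
  have hcard : (Fintype.card (Fin l → Fin c → PerfectMatching (M / l)) : ℝ) ≠ 0 := by
    exact_mod_cast Fintype.card_ne_zero
  rw [← expect_pickVertices hl ρ N (fun v => (∑ σ : Fin l → Fin c → PerfectMatching (M / l),
    A.acceptProbOn (inducedInput σ v)) / Fintype.card (Fin l → Fin c → PerfectMatching (M / l))) G]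
  · change expect (graphDist N c M l) _ = _
    rw [graphDist, expect_andThen, expect_draw_univ]
    simp only [expect_andThen, expect_pure]
    rw [expect_sum, expect_div]
    refine expect_congr _ fun o => ?_
    cases o
    · simp
    · rfl
  · intro v hv
    rw [hG v hv, mul_div_cancel_right₀ _ hcard]

open Classical in
/-- The acceptance probability differs from a rational function of `M` and `l` by at most a multiple
of the probability that the process fails. -/
theorem exists_numerator_acceptProb {N c T : ℕ} (A : QueryAlgorithm N c T) :
    ∃ f : MvPolynomial (Fin 2) ℝ, f.totalDegree ≤ ∑ k ∈ Finset.Icc 1 (2 * T), 2 * T / k ∧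
      ∀ m l : ℕ, 0 < l → Even m → (∀ k ∈ Finset.Icc 1 (2 * T), 2 * k ≤ m) → 0 < m →
        ∀ ρ : ℝ, 0 ≤ ρ → ρ ≤ 1 →
          |acceptProb A (m * l) l ρ - MvPolynomial.eval ![((m * l : ℕ) : ℝ), (l : ℝ)] f
              / MvPolynomial.eval ![((m * l : ℕ) : ℝ), (l : ℝ)] (denominator (2 * T))|
            ≤ (1 + (1 + 2 * (N * (c * N) : ℝ)) ^ (2 * T))
              * ((Finset.univ.filter fun φ : Fin N → Fin l => ¬ Fits m φ).card / (l : ℝ) ^ N) := by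
  obtain ⟨ι, _, L, w, hι, hL, hw, hacc⟩ := A.exists_acceptProbOn_expansion
  choose W f hf hW hcount heval using fun i => exists_sat_weight (L i) (hL i)
  refine ⟨∑ i, MvPolynomial.C (w i) * f i, ?_, fun m l hl hm hk hmpos ρ hρ hρ' => ?_⟩
  · refine MvPolynomial.totalDegree_finsetSum_le fun i _ => ?_
    refine (MvPolynomial.totalDegree_mul _ _).trans ?_
    rw [MvPolynomial.totalDegree_C, zero_add]
    exact hf i
  have hl' : (0 : ℝ) < l := by exact_mod_cast hl
  have hM : (0 : ℝ) < (m * l : ℕ) := by positivity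
  have hdiv : ((m * l : ℕ) : ℝ) / l = m := by
    push_cast
    field_simp
  have hk1 : ∀ k ∈ Finset.Icc 1 (2 * T), 1 ≤ (m : ℝ) - (2 * (k : ℝ) - 1) := by
    intro k hk'
    have : (2 * k : ℝ) ≤ m := by exact_mod_cast hk k hk'
    linarith
  have hk2 : ∀ k ∈ Finset.Icc 1 (2 * T), ((m * l : ℕ) : ℝ) - (2 * (k : ℝ) - 1) * l ≠ 0 := by
    intro k hk'
    have := hk1 k hk'
    push_cast
    rw [← sub_mul]
    exact mul_ne_zero (by linarith) hl'.ne'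
  have hg : MvPolynomial.eval ![((m * l : ℕ) : ℝ), (l : ℝ)] (denominator (2 * T)) ≠ 0 := by
    rw [denominator, map_prod]
    refine Finset.prod_ne_zero_iff.2 fun k hk' => ?_
    rw [map_pow, eval_linFactor]
    exact pow_ne_zero _ (hk2 k hk')
  have hml : m * l / l = m := Nat.mul_div_cancel _ hl
  set G : (Fin N → Fin l) → ℝ := fun φ => ∑ i, w i * W i l m φ with hG
  have hGabs : ∀ φ, |G φ| ≤ (1 + 2 * (N * (c * N) : ℝ)) ^ (2 * T) := by
    intro φ
    have h1 : |G φ| ≤ Fintype.card ι := by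
      refine (Finset.abs_sum_le_sum_abs _ _).trans ?_
      refine (Finset.sum_le_card_nsmul _ _ 1 fun i _ => ?_).trans (by simp)
      rw [abs_mul]
      exact mul_le_one₀ (hw i) (abs_nonneg _) (hW i l m φ hk1)
    exact h1.trans (by exact_mod_cast hι)
  -- The rational function is the average of `G` over all assignments; the acceptance probability
  -- has `ρ` in place of `G` where they do not fit.
  have hf' : MvPolynomial.eval ![((m * l : ℕ) : ℝ), (l : ℝ)] (∑ i, MvPolynomial.C (w i) * f i)
      / MvPolynomial.eval ![((m * l : ℕ) : ℝ), (l : ℝ)] (denominator (2 * T))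
      = (∑ φ, G φ) / (l : ℝ) ^ N := by
    rw [div_eq_iff hg, map_sum, hG, Finset.sum_comm, Finset.sum_div, Finset.sum_mul]
    refine Finset.sum_congr rfl fun i _ => ?_
    rw [map_mul, MvPolynomial.eval_C, heval i _ l hM hl hk2, hdiv, ← Finset.mul_sum]
    ring
  have hacc' : acceptProb A (m * l) l ρ = (∑ φ, if Fits m φ then G φ else ρ) / (l : ℝ) ^ N := by
    have h := acceptProb_eq_sum (M := m * l) A hl (by rwa [hml]) ρ G
    rw [hml] at h
    refine h fun v hv => ?_
    simp only [hacc, hG]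
    rw [Finset.sum_comm, Finset.sum_mul]
    refine Finset.sum_congr rfl fun i _ => ?_
    rw [← Finset.mul_sum, hcount i l m hm v hv, mul_assoc]
  rw [hf', hacc', ← sub_div, ← Finset.sum_sub_distrib, abs_div, abs_of_pos (pow_pos hl' N),
    ← mul_div_assoc]
  gcongr
  refine (Finset.abs_sum_le_sum_abs _ _).trans ?_
  rw [← Finset.sum_boole, Finset.mul_sum]
  refine Finset.sum_le_sum fun φ _ => ?_
  by_cases hφ : Fits m φ
  · simp [hφ]
  · simp only [hφ, if_false, not_false_eq_true, if_true, mul_one]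
    refine (abs_sub _ _).trans (add_le_add ?_ (hGabs φ))
    rwa [abs_of_nonneg hρ]

/-! ### Asymptotics -/

/-- The sum is at most `2T` times a harmonic number. For `T ≥ 1` both `1` and `log (2T)` are at most
`2 log (T + 1)`, whence the constant `8`. -/
theorem sum_div_le_mul_log (T : ℕ) :
    ((∑ k ∈ Finset.Icc 1 (2 * T), 2 * T / k : ℕ) : ℝ) ≤ 8 * (T * Real.log (T + 1)) := by
  rcases Nat.eq_zero_or_pos T with rfl | hT
  · simp
  have hT' : (1 : ℝ) ≤ T := by exact_mod_cast hT
  have h1 : ((∑ k ∈ Finset.Icc 1 (2 * T), 2 * T / k : ℕ) : ℝ)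
      ≤ (2 * T : ℕ) * (harmonic (2 * T) : ℝ) := by
    rw [harmonic_eq_sum_Icc]
    push_cast
    rw [Finset.mul_sum]
    refine Finset.sum_le_sum fun k _ => ?_
    rw [← div_eq_mul_inv]
    exact_mod_cast Nat.cast_div_le (α := ℝ) (m := 2 * T) (n := k)
  have h2 := harmonic_le_one_add_log (2 * T)
  have h3 : Real.log (2 * T : ℕ) ≤ 2 * Real.log (T + 1) := by
    rw [← Real.log_rpow (by linarith)]
    refine Real.log_le_log (by push_cast; linarith) ?_
    push_cast
    norm_cast
    nlinarith
  have h4 : 1 ≤ 2 * Real.log (T + 1) := by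
    have : Real.log 2 ≤ Real.log (T + 1) := Real.log_le_log (by norm_num) (by linarith)
    linarith [Real.log_two_gt_d9]
  calc ((∑ k ∈ Finset.Icc 1 (2 * T), 2 * T / k : ℕ) : ℝ)
      ≤ (2 * T : ℕ) * (harmonic (2 * T) : ℝ) := h1
    _ ≤ (2 * T : ℕ) * (4 * Real.log (T + 1)) := by
        gcongr
        linarith
    _ = 8 * (T * Real.log (T + 1)) := by
        push_cast
        ring

-- The power is at most `N ^ (6T) ≤ exp (6 √N log N)`. The added `1` and the factor `N ^ (1/4)`
-- raise `6` to at most `8`, and eventually `log N ≤ (b / 8) N ^ 0.05`.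
open Filter in
theorem eventually_error_le (c : ℕ) {b : ℝ} (hb : 0 < b) :
    ∀ᶠ N : ℕ in atTop, ∀ T : ℕ, (T : ℝ) ≤ (N : ℝ) ^ (1 / 2 : ℝ) →
      (1 + (1 + 2 * (N * (c * N) : ℝ)) ^ (2 * T)) * (N : ℝ) ^ (1 / 4 : ℝ)
        ≤ Real.exp (b * (N : ℝ) ^ (0.55 : ℝ)) := by
  have hlog := (isLittleO_log_rpow_atTop (show (0 : ℝ) < 0.05 by norm_num)).bound
    (show 0 < b / 8 by positivity)
  filter_upwards [tendsto_natCast_atTop_atTop.eventually hlog,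
    tendsto_natCast_atTop_atTop.eventually (eventually_ge_atTop (2 + 2 * c : ℝ))] with N hN hN' T hT
  set x : ℝ := (N : ℝ) with hx
  have hx2 : 2 ≤ x := by
    have : (0 : ℝ) ≤ c := by positivity
    linarith
  have hx0 : 0 < x := by linarith
  have hlog0 : 0 ≤ Real.log x := Real.log_nonneg (by linarith)
  rw [Real.norm_of_nonneg hlog0, Real.norm_of_nonneg (by positivity)] at hN
  have hsq : 1 ≤ x ^ (1 / 2 : ℝ) := Real.one_le_rpow (by linarith) (by norm_num)
  have h1 : 1 + 2 * (x * (c * x)) ≤ x ^ 3 := by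
    have : (2 + 2 * (c : ℝ)) * x ^ 2 ≤ x * x ^ 2 := by gcongr
    nlinarith
  have h2 : (1 + 2 * (x * (c * x))) ^ (2 * T) ≤ Real.exp (6 * x ^ (1 / 2 : ℝ) * Real.log x) := by
    calc (1 + 2 * (x * (c * x))) ^ (2 * T) ≤ (x ^ 3) ^ (2 * T) := by gcongr
      _ = Real.exp (Real.log x) ^ (6 * T) := by
          rw [Real.exp_log hx0, ← pow_mul]
          congr 1
          ring
      _ = Real.exp (6 * T * Real.log x) := by
          rw [← Real.exp_nat_mul]
          push_cast
          rfl
      _ ≤ _ := by gcongr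
  have h3 : 1 + (1 + 2 * (x * (c * x))) ^ (2 * T)
      ≤ Real.exp (7 * x ^ (1 / 2 : ℝ) * Real.log x) := by
    have h4 : (1 : ℝ) ≤ Real.exp (6 * x ^ (1 / 2 : ℝ) * Real.log x) := by
      rw [Real.one_le_exp_iff]
      positivity
    have h5 : x ≤ Real.exp (x ^ (1 / 2 : ℝ) * Real.log x) := by
      calc x = Real.exp (1 * Real.log x) := by rw [one_mul, Real.exp_log hx0]
        _ ≤ _ := by gcongr
    calc 1 + (1 + 2 * (x * (c * x))) ^ (2 * T)
        ≤ 2 * Real.exp (6 * x ^ (1 / 2 : ℝ) * Real.log x) := by linarith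
      _ ≤ Real.exp (x ^ (1 / 2 : ℝ) * Real.log x)
          * Real.exp (6 * x ^ (1 / 2 : ℝ) * Real.log x) := by
          gcongr
          exact hx2.trans h5
      _ = _ := by
          rw [← Real.exp_add]
          congr 1
          ring
  have h6 : x ^ (1 / 4 : ℝ) ≤ Real.exp (x ^ (1 / 2 : ℝ) * Real.log x) := by
    rw [Real.rpow_def_of_pos hx0]
    refine Real.exp_le_exp.2 ?_
    nlinarith
  calc (1 + (1 + 2 * (x * (c * x))) ^ (2 * T)) * x ^ (1 / 4 : ℝ)
      ≤ Real.exp (7 * x ^ (1 / 2 : ℝ) * Real.log x)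
        * Real.exp (x ^ (1 / 2 : ℝ) * Real.log x) := by gcongr
    _ = Real.exp (8 * x ^ (1 / 2 : ℝ) * Real.log x) := by
        rw [← Real.exp_add]
        congr 1
        ring
    _ ≤ Real.exp (8 * x ^ (1 / 2 : ℝ) * (b / 8 * x ^ (0.05 : ℝ))) := by gcongr
    _ = Real.exp (b * x ^ (0.55 : ℝ)) := by
        congr 1
        rw [show (0.55 : ℝ) = 1 / 2 + 0.05 by norm_num, Real.rpow_add hx0]
        ring

open Filter in
theorem eventually_mul_rpow_le (a : ℝ) :
    ∀ᶠ N : ℕ in atTop, a * (N : ℝ) ^ (-(1 / 10) : ℝ) ≤ 2 := by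
  have h : Tendsto (fun N : ℕ => a * (N : ℝ) ^ (-(1 / 10) : ℝ)) atTop (nhds (a * 0)) :=
    ((tendsto_rpow_neg_atTop (by norm_num)).comp tendsto_natCast_atTop_atTop).const_mul a
  rw [mul_zero] at h
  exact h.eventually_le_const (by norm_num)

/-- The parameters of the construction leave room for the edges seen by the algorithm. -/
theorem two_mul_le_of_mem_Icc {N T m l k : ℕ} (hN : 256 ≤ N) (hT : (T : ℝ) ≤ (N : ℝ) ^ (1 / 2 : ℝ))
    (hl : (l : ℝ) ≤ (N : ℝ) ^ (1 / 4 : ℝ)) (hm : (N : ℝ) ≤ m * l)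
    (hk : k ∈ Finset.Icc 1 (2 * T)) : 2 * k ≤ m := by
  have hN' : (256 : ℝ) ≤ N := by exact_mod_cast hN
  have hN0 : (0 : ℝ) < N := by linarith
  -- One factor `N ^ (1/4)` pays for `l`, the other is at least `4` because `N ≥ 256`; hence `m ≥ 4
  -- √N ≥ 4T`.
  have h1 : (N : ℝ) = (N : ℝ) ^ (1 / 4 : ℝ) * (N : ℝ) ^ (1 / 2 : ℝ) * (N : ℝ) ^ (1 / 4 : ℝ) := by
    rw [← Real.rpow_add hN0, ← Real.rpow_add hN0]
    norm_num
  have h2 : (4 : ℝ) ≤ (N : ℝ) ^ (1 / 4 : ℝ) := by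
    calc (4 : ℝ) = (256 : ℝ) ^ (1 / 4 : ℝ) := by
          rw [show (256 : ℝ) = 4 ^ (4 : ℝ) by norm_num, ← Real.rpow_mul (by norm_num)]
          norm_num
      _ ≤ _ := by gcongr
  have h3 : (k : ℝ) ≤ 2 * T := by exact_mod_cast (Finset.mem_Icc.1 hk).2
  have hq : (0 : ℝ) < (N : ℝ) ^ (1 / 4 : ℝ) := by positivity
  have h4 : 4 * (N : ℝ) ^ (1 / 2 : ℝ) * (N : ℝ) ^ (1 / 4 : ℝ) ≤ m * (N : ℝ) ^ (1 / 4 : ℝ) := by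
    calc 4 * (N : ℝ) ^ (1 / 2 : ℝ) * (N : ℝ) ^ (1 / 4 : ℝ)
        ≤ (N : ℝ) ^ (1 / 4 : ℝ) * (N : ℝ) ^ (1 / 2 : ℝ) * (N : ℝ) ^ (1 / 4 : ℝ) := by gcongr
      _ = N := h1.symm
      _ ≤ m * l := hm
      _ ≤ m * (N : ℝ) ^ (1 / 4 : ℝ) := by gcongr
  have h5 := le_of_mul_le_mul_right h4 hq
  have h6 : (2 * k : ℝ) ≤ m := by linarith
  exact_mod_cast h6

end GraphQuery

/-! ### The main theorem. -/

theorem mainTheorem4 :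
    ∃ K : ℝ, 0 < K ∧ ∀ (c : ℕ) (a : ℝ), 0 < a → ∃ κ : ℝ, 0 < κ ∧ ∃ N₀ : ℕ,
      ∀ N : ℕ, N₀ ≤ N → ∀ T : ℕ, (T : ℝ) ≤ (N : ℝ) ^ (1 / 2 : ℝ) →
      ∀ A : GraphQuery.QueryAlgorithm N c T,
      ∃ (f g : MvPolynomial (Fin 2) ℝ) (e : ℕ → ℕ),
        (f.totalDegree : ℝ) ≤ K * (T * Real.log (T + 1)) ∧
        (g.totalDegree : ℝ) ≤ K * (T * Real.log (T + 1)) ∧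
        g = ∏ k ∈ Finset.Icc 1 (2 * T), GraphQuery.linFactor k ^ e k ∧
        (∀ k ∈ Finset.Icc 1 (2 * T), (e k : ℝ) ≤ 2 * (T : ℝ) / (k : ℝ)) ∧
        ∀ M l : ℕ, 0 < l → 2 * l ∣ M → (l : ℝ) ≤ (N : ℝ) ^ (1 / 4 : ℝ) →
          (1 + a * (N : ℝ) ^ (-(1 / 10) : ℝ)) * (N : ℝ) ≤ (M : ℝ) →
          MvPolynomial.eval ![(M : ℝ), (l : ℝ)] g ≠ 0 ∧
          ∀ ρ : ℝ, 0 ≤ ρ → ρ ≤ 1 →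
            |GraphQuery.acceptProb A M l ρ
                - MvPolynomial.eval ![(M : ℝ), (l : ℝ)] f / MvPolynomial.eval ![(M : ℝ), (l : ℝ)] g|
              ≤ Real.exp (-κ * (N : ℝ) ^ (0.55 : ℝ)) := by
  classical
  -- `κ` is half the Chernoff rate `a ^ 2 / 4`; the other half absorbs the number of terms and the
  -- factor `l`.
  refine ⟨8, by norm_num, fun c a ha => ⟨a ^ 2 / 8, by positivity, ?_⟩⟩
  obtain ⟨N₀, hN₀⟩ := Filter.eventually_atTop.1
    ((GraphQuery.eventually_error_le c (show 0 < a ^ 2 / 8 by positivity)).and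
      ((GraphQuery.eventually_mul_rpow_le a).and (Filter.eventually_ge_atTop 256)))
  refine ⟨N₀, fun N hN T hT A => ?_⟩
  obtain ⟨herr, hδ2, hN256⟩ := hN₀ N hN
  have hN0 : (0 : ℝ) < N := by exact_mod_cast (by omega : 0 < N)
  obtain ⟨f, hf, hfA⟩ := GraphQuery.exists_numerator_acceptProb A
  have hdeg := GraphQuery.sum_div_le_mul_log T
  refine ⟨f, GraphQuery.denominator (2 * T), fun k => 2 * T / k,
    (Nat.cast_le.2 hf).trans hdeg,
    (Nat.cast_le.2 (GraphQuery.totalDegree_denominator_le _)).trans hdeg, rfl,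
    fun k _ => by exact_mod_cast Nat.cast_div_le (α := ℝ) (m := 2 * T) (n := k), ?_⟩
  intro M l hl hdvd hlN hM
  obtain ⟨r, rfl⟩ := hdvd
  obtain ⟨m, hm⟩ : ∃ m, m = 2 * r := ⟨_, rfl⟩
  have hml : 2 * l * r = m * l := by
    rw [hm]
    ring
  rw [hml] at hM ⊢
  have hl' : (0 : ℝ) < l := by exact_mod_cast hl
  set δ := a * (N : ℝ) ^ (-(1 / 10) : ℝ) with hδ
  have hδ0 : 0 ≤ δ := by positivity
  have hM' : (1 + δ) * N ≤ m * l := by exact_mod_cast hM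
  have hNml : (N : ℝ) ≤ m * l := by nlinarith
  have hk : ∀ k ∈ Finset.Icc 1 (2 * T), 2 * k ≤ m := fun k hk =>
    GraphQuery.two_mul_le_of_mem_Icc hN256 hT hlN hNml hk
  have hmpos : 0 < m := by
    rcases Nat.eq_zero_or_pos m with h | h
    · rw [h] at hNml
      simp only [Nat.cast_zero, zero_mul] at hNml
      linarith
    · exact h
  refine ⟨?_, fun ρ hρ hρ' => ?_⟩
  · rw [GraphQuery.denominator, map_prod]
    refine Finset.prod_ne_zero_iff.2 fun k hk' => ?_
    rw [map_pow, GraphQuery.eval_linFactor]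
    refine pow_ne_zero _ ?_
    have : (2 * k : ℝ) ≤ m := by exact_mod_cast hk k hk'
    push_cast
    rw [← sub_mul]
    exact mul_ne_zero (by linarith) hl'.ne'
  · refine (hfA m l hl ⟨r, by omega⟩ hk hmpos ρ hρ hρ').trans ?_
    -- The exponent is `0.55 = 3/4 - 1/5`, from `N / l ≥ N ^ (3/4)` and `δ ^ 2 = a ^ 2 * N ^
    -- (-1/5)`.
    have hrate : a ^ 2 / 4 * (N : ℝ) ^ (0.55 : ℝ) ≤ N / l * δ ^ 2 / 4 := by
      have h1 : δ ^ 2 = a ^ 2 * (N : ℝ) ^ (-(1 / 5) : ℝ) := by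
        rw [hδ, mul_pow, ← Real.rpow_natCast (_ ^ _), ← Real.rpow_mul hN0.le]
        norm_num
      have h2 : (N : ℝ) ^ (3 / 4 : ℝ) ≤ N / l := by
        rw [le_div_iff₀ hl']
        calc (N : ℝ) ^ (3 / 4 : ℝ) * l ≤ (N : ℝ) ^ (3 / 4 : ℝ) * (N : ℝ) ^ (1 / 4 : ℝ) := by gcongr
          _ = N := by
              rw [← Real.rpow_add hN0]
              norm_num
      have h3 : (N : ℝ) ^ (0.55 : ℝ) = (N : ℝ) ^ (3 / 4 : ℝ) * (N : ℝ) ^ (-(1 / 5) : ℝ) := by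
        rw [← Real.rpow_add hN0]
        norm_num
      calc a ^ 2 / 4 * (N : ℝ) ^ (0.55 : ℝ)
          = (N : ℝ) ^ (3 / 4 : ℝ) * δ ^ 2 / 4 := by
            rw [h1, h3]
            ring
        _ ≤ N / l * δ ^ 2 / 4 := by gcongr
    calc (1 + (1 + 2 * (N * (c * N) : ℝ)) ^ (2 * T)) * ((Finset.univ.filter
            fun φ : Fin N → Fin l => ¬ GraphQuery.Fits m φ).card / (l : ℝ) ^ N)
        ≤ (1 + (1 + 2 * (N * (c * N) : ℝ)) ^ (2 * T)) * ((N : ℝ) ^ (1 / 4 : ℝ)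
            * Real.exp (-(a ^ 2 / 4 * (N : ℝ) ^ (0.55 : ℝ)))) := by
          gcongr
          refine (GraphQuery.card_not_fits_div_le hl hδ0 hδ2 hM').trans ?_
          gcongr
      _ ≤ Real.exp (a ^ 2 / 8 * (N : ℝ) ^ (0.55 : ℝ))
            * Real.exp (-(a ^ 2 / 4 * (N : ℝ) ^ (0.55 : ℝ))) := by
          rw [← mul_assoc]
          gcongr
          exact herr T hT
      _ = Real.exp (-(a ^ 2 / 8) * (N : ℝ) ^ (0.55 : ℝ)) := by
          rw [← Real.exp_add]
          congr 1
          ring
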